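/- Let $\mathbb F_q$ be the finite field with $q\ge 2$ elements, let $g\in\mathbb F_q[x]$ be a polynomial (not necessarily monic) of degree $\delta\ge 1$, and let $n\ge\delta$ be an integer. Let $R(n,g,q)$ be the number of monic polynomials $f\in\mathbb F_q[x]$ of degree $n$ which can be written in the form $f=h+g^k$, where $h\in\mathbb F_q[x]$ is a monic irreducible polynomial of degree $n$ and $k\ge 0$ is an integer, and put $r(n,g,q)=R(n,g,q)/q^n$. Let $\widetilde R(n,g,q)$ be the number of (not necessarily monic) polynomials $f\in\mathbb F_q[x]$ of degree $n$ which can be written in the form $f=h+g^k$, where $h\in\mathbb F_q[x]$ is a (not necessarily monic) irreducible polynomial of degree $n$ and $k\ge 0$ is an integer, and put $\widetilde r(n,g,q)=\widetilde R(n,g,q)/((q-1)q^n)$. Then $$\frac{2}{\delta}\ \ge\ r(n,g,q)\ >\ \frac{0.01}{\delta}\qquad\text{and}\qquad \frac{2}{\delta}\ \ge\ \widetilde r(n,g,q)\ >\ \frac{0.01}{\delta}.$$ -/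

import Mathlib

open Polynomial

/-- The monic polynomials `f` of degree `n` over `F` of the form `f = h + g ^ k` with
`h` monic irreducible of degree `n` and `k` a nonnegative integer. -/
def monicRomanoffSet {F : Type*} [Field F] (n : ℕ) (g : F[X]) : Set F[X] :=
  {f | f.Monic ∧ f.degree = (n : WithBot ℕ) ∧
    ∃ (h : F[X]) (k : ℕ), h.Monic ∧ Irreducible h ∧ h.degree = (n : WithBot ℕ) ∧ f = h + g ^ k}

/-- The (not necessarily monic) polynomials `f` of degree `n` over `F` of the form
`f = h + g ^ k` with `h` (not necessarily monic) irreducible of degree `n` and `k` a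
nonnegative integer. -/
def romanoffSet {F : Type*} [Field F] (n : ℕ) (g : F[X]) : Set F[X] :=
  {f | f.degree = (n : WithBot ℕ) ∧
    ∃ (h : F[X]) (k : ℕ), Irreducible h ∧ h.degree = (n : WithBot ℕ) ∧ f = h + g ^ k}

/-- `r(n, g, q)`: the proportion, among the `q ^ n` monic polynomials of degree `n`, of those
in `monicRomanoffSet n g`. Here `q` is the order of the field `F`. -/
noncomputable def monicRomanoffDensity {F : Type*} [Field F] (n : ℕ) (g : F[X]) : ℝ :=
  ((monicRomanoffSet n g).ncard : ℝ) / (Nat.card F : ℝ) ^ n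

/-- `r̃(n, g, q)`: the proportion, among the `(q - 1) * q ^ n` polynomials of degree `n`, of
those in `romanoffSet n g`. Here `q` is the order of the field `F`. -/
noncomputable def romanoffDensity {F : Type*} [Field F] (n : ℕ) (g : F[X]) : ℝ :=
  ((romanoffSet n g).ncard : ℝ) / (((Nat.card F : ℝ) - 1) * (Nat.card F : ℝ) ^ n)

/-! Write `q` for the order of the field, `δ` for the degree of `g`, and `π(n)` for the number of
monic irreducibles of degree `n`. The upper bounds are a count of representations: `π(n) ≤ q^n / n`,
and at most `n/δ + 1 ≤ 2n/δ` exponents can occur.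

The lower bounds follow Romanoff's second-moment method. With `K = ⌈n/δ⌉`, Cauchy–Schwarz compares
the square of the number `π(n) * K` of pairs `(h, k)` with the number of values `h + u * g^k` times
the number of coincidences. A coincidence with exponents `a ≠ b` is an irreducible `h` for which `h
+ u * (g^a - g^b)` is irreducible as well. A large sieve (`card_sifted_mul_le`,
`card_irreducible_pairs_le`) bounds these by `8 q^n / ((n+1)(n+3))` times a singular factor.
Romanoff's lemma (`sum_eulerFactor_le`) shows that this factor is at most `12 δ` on average: it is
expanded over squarefree moduli, the order of `g` modulo each of them enters, and few primes have
small order because they divide a product of the `g^t - 1`. The prime products are controlled by an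
explicit Mertens bound. If `n < 50 δ`, the single exponent `k = 0` suffices.

The scalar `u` serves the non-monic problem: `c * h + g^k = c * (h + c⁻¹ * g^k)`, so that problem is
the union over `c` of the monic ones with `u = c⁻¹`. -/

open UniqueFactorizationMonoid in
theorem mem_primeFactors_iff_monic {F : Type*} [Field F] [DecidableEq F] {a P : F[X]} (ha : a ≠ 0) :
    P ∈ primeFactors a ↔ P.Monic ∧ Irreducible P ∧ P ∣ a := by
  rw [mem_primeFactors, mem_normalizedFactors_iff' ha]
  constructor
  · rintro ⟨h1, h2, h3⟩
    exact ⟨h2 ▸ Polynomial.monic_normalize h1.ne_zero, h1, h3⟩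
  · rintro ⟨h1, h2, h3⟩
    exact ⟨h2, h1.normalize_eq_self, h3⟩

/-! ### Counting monic and monic irreducible polynomials of a given degree. -/

theorem finite_monic_natDegree (F : Type*) [Field F] [Finite F] (n : ℕ) :
    {f : F[X] | f.Monic ∧ f.natDegree = n}.Finite := by
  have : Finite (degreeLT F n) := Finite.of_equiv _ (degreeLTEquiv F n).toEquiv.symm
  have : Finite {f : F[X] | f.Monic ∧ f.natDegree = n} :=
    Finite.of_equiv _ (monicEquivDegreeLT n).symm
  exact Set.toFinite _

/-- The monic polynomials of degree `n` over a finite field. -/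
noncomputable def monicsOfDegree (F : Type*) [Field F] [Finite F] (n : ℕ) : Finset F[X] :=
  (finite_monic_natDegree F n).toFinset

open Classical in
/-- The monic irreducible polynomials of degree `n` over a finite field. -/
noncomputable def irredsOfDegree (F : Type*) [Field F] [Finite F] (n : ℕ) : Finset F[X] :=
  (monicsOfDegree F n).filter Irreducible

section
variable {F : Type*} [Field F] [Finite F]

@[simp] theorem mem_monicsOfDegree {n : ℕ} {f : F[X]} :
    f ∈ monicsOfDegree F n ↔ f.Monic ∧ f.natDegree = n := by
  simp [monicsOfDegree]

@[simp] theorem mem_irredsOfDegree {n : ℕ} {f : F[X]} :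
    f ∈ irredsOfDegree F n ↔ (f.Monic ∧ f.natDegree = n) ∧ Irreducible f := by
  simp [irredsOfDegree]

theorem card_monicsOfDegree (n : ℕ) : (monicsOfDegree F n).card = Nat.card F ^ n := by
  have h : Nat.card {f : F[X] // f.Monic ∧ f.natDegree = n} = Nat.card F ^ n := by
    rw [Nat.card_congr ((monicEquivDegreeLT n).trans (degreeLTEquiv F n).toEquiv), Nat.card_fun,
      Nat.card_eq_fintype_card (α := Fin n), Fintype.card_fin]
  rw [← h]
  exact (Set.ncard_eq_toFinset_card _ (finite_monic_natDegree F n)).symm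

-- Gauss's formula: `X^(q^n) - X` is separable, hence associated to its radical, and its monic
-- irreducible factors are those of degree dividing `n`. The two sides are the degrees.
open UniqueFactorizationMonoid in
theorem sum_divisors_mul_card_irredsOfDegree {n : ℕ} (hn : n ≠ 0) :
    ∑ d ∈ n.divisors, d * (irredsOfDegree F d).card = Nat.card F ^ n := by
  classical
  have h1 : 1 < Nat.card F := Finite.one_lt_card
  set G : F[X] := X ^ Nat.card F ^ n - X with hG
  have hG0 : G ≠ 0 := FiniteField.X_pow_card_pow_sub_X_ne_zero F hn h1
  have hdeg : G.natDegree = Nat.card F ^ n :=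
    FiniteField.X_pow_card_pow_sub_X_natDegree_eq F hn h1
  have hsep : G.Separable := by
    obtain ⟨p, hp⟩ := CharP.exists F
    have := Fintype.ofFinite F
    apply galois_poly_separable p
    have h0 : ((Nat.card F : ℕ) : F) = 0 := by simp
    exact dvd_pow ((CharP.cast_eq_zero_iff F p _).1 h0) hn
  have hassoc : Associated (radical G) G :=
    radical_associated hsep.squarefree.isRadical hG0
  have hPF : primeFactors G = n.divisors.biUnion (irredsOfDegree F) := by
    ext P
    rw [mem_primeFactors_iff_monic hG0]
    simp only [Finset.mem_biUnion, Nat.mem_divisors, mem_irredsOfDegree]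
    constructor
    · rintro ⟨h1, h2, h3⟩
      exact ⟨P.natDegree, ⟨h2.natDegree_dvd_iff_dvd_X_pow_card_pow_sub_X.2 h3, hn⟩, ⟨h1, rfl⟩, h2⟩
    · rintro ⟨d, ⟨hd, -⟩, ⟨h1, rfl⟩, h2⟩
      exact ⟨h1, h2, h2.natDegree_dvd_iff_dvd_X_pow_card_pow_sub_X.1 hd⟩
  have h2 : (radical G).natDegree = ∑ d ∈ n.divisors, d * (irredsOfDegree F d).card := by
    rw [radical, hPF, natDegree_prod_of_monic, Finset.sum_biUnion]
    · refine Finset.sum_congr rfl fun d _ => ?_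
      rw [Finset.sum_congr rfl (g := fun _ => d)]
      · simp [mul_comm]
      · intro P hP
        exact (mem_irredsOfDegree.1 hP).1.2
    · intro i _ j _ hij
      rw [Function.onFun, Finset.disjoint_left]
      intro P h1 h2
      exact hij ((mem_irredsOfDegree.1 h1).1.2.symm.trans (mem_irredsOfDegree.1 h2).1.2)
    · intro P hP
      simp only [Finset.mem_biUnion, mem_irredsOfDegree] at hP
      obtain ⟨d, -, hP⟩ := hP
      exact hP.1.1
  rw [← h2, ← hdeg]
  exact natDegree_eq_of_degree_eq (degree_eq_degree_of_associated hassoc)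

theorem card_irredsOfDegree_one : (irredsOfDegree F 1).card = Nat.card F := by
  simpa using sum_divisors_mul_card_irredsOfDegree (F := F) one_ne_zero

theorem mul_card_irredsOfDegree_le {n : ℕ} (hn : n ≠ 0) :
    n * (irredsOfDegree F n).card ≤ Nat.card F ^ n := by
  rw [← sum_divisors_mul_card_irredsOfDegree hn]
  exact Finset.single_le_sum (f := fun d => d * (irredsOfDegree F d).card)
    (fun _ _ => Nat.zero_le _) (Nat.mem_divisors_self n hn)

/-- Keeping the divisor `1` saves a term `q`, which later gives `π(n) / (q^n - 1) ≤ 1 / n` in the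
Mertens product. -/
theorem mul_card_irredsOfDegree_add_le {n : ℕ} (hn : 2 ≤ n) :
    n * (irredsOfDegree F n).card + Nat.card F ≤ Nat.card F ^ n := by
  have hn0 : n ≠ 0 := by omega
  rw [← sum_divisors_mul_card_irredsOfDegree (F := F) hn0]
  have h : ({n, 1} : Finset ℕ) ⊆ n.divisors := by
    intro d; simp only [Finset.mem_insert, Finset.mem_singleton, Nat.mem_divisors]
    rintro (rfl | rfl) <;> simp [hn0]
  refine le_trans (le_of_eq ?_) (Finset.sum_le_sum_of_subset h)
  rw [Finset.sum_pair (by omega), card_irredsOfDegree_one, one_mul]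

theorem sum_Icc_pow_add_two_le {q : ℕ} (hq : 2 ≤ q) (m : ℕ) :
    ∑ d ∈ Finset.Icc 1 m, q ^ d + 2 ≤ 2 * q ^ m := by
  induction m with
  | zero => simp
  | succ m ih =>
    rw [Finset.sum_Icc_succ_top (by omega)]
    have : 2 * q ^ m ≤ q ^ (m + 1) := by rw [pow_succ, mul_comm]; gcongr
    omega

/-- Proper divisors of `n` are at most `n / 2`, so they contribute at most a geometric sum to
Gauss's formula. -/
theorem card_pow_add_two_le {n : ℕ} (hn : n ≠ 0) :
    Nat.card F ^ n + 2 ≤ n * (irredsOfDegree F n).card + 2 * Nat.card F ^ (n / 2) := by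
  have hq : 2 ≤ Nat.card F := Finite.one_lt_card
  have h1 := sum_Icc_pow_add_two_le hq (n / 2)
  rw [← sum_divisors_mul_card_irredsOfDegree (F := F) hn, ← Nat.cons_self_properDivisors hn,
    Finset.sum_cons]
  have h2 : ∑ d ∈ n.properDivisors, d * (irredsOfDegree F d).card
      ≤ ∑ d ∈ Finset.Icc 1 (n / 2), Nat.card F ^ d := by
    calc _ ≤ ∑ d ∈ n.properDivisors, Nat.card F ^ d := by
          refine Finset.sum_le_sum fun d hd => mul_card_irredsOfDegree_le ?_
          exact (Nat.pos_of_mem_properDivisors hd).ne'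
      _ ≤ _ := by
          refine Finset.sum_le_sum_of_subset fun d hd => ?_
          have h0 := Nat.pos_of_mem_properDivisors hd
          obtain ⟨⟨k, rfl⟩, h⟩ := Nat.mem_properDivisors.1 hd
          rw [Finset.mem_Icc]
          refine ⟨h0, ?_⟩
          rw [Nat.le_div_iff_mul_le two_pos]
          refine Nat.mul_le_mul_left d ?_
          by_contra! hk
          interval_cases k <;> simp at h
  omega

theorem card_pow_le_two_mul {n : ℕ} (hn : n ≠ 0) :
    Nat.card F ^ n ≤ 2 * (n * (irredsOfDegree F n).card) := by
  have h := card_pow_add_two_le (F := F) hn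
  have hq : 2 ≤ Nat.card F := Finite.one_lt_card
  -- This is `(y - 2)² ≥ 0` for `y = q^(n/2)`, together with `y² ≤ q^n`.
  have h1 : 4 * Nat.card F ^ (n / 2) ≤ Nat.card F ^ n + 4 := by
    have h2 : Nat.card F ^ (2 * (n / 2)) ≤ Nat.card F ^ n :=
      Nat.pow_le_pow_right (by omega) (by omega)
    rw [mul_comm, pow_mul] at h2
    zify at h2 ⊢
    nlinarith [sq_nonneg ((Nat.card F : ℤ) ^ (n / 2) - 2)]
  omega

end

/-! ### Explicit Mertens bounds for products over primes. -/

/-- The reciprocal of the number of residue classes modulo `P`. -/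
noncomputable def invNorm {F : Type*} [Field F] (P : F[X]) : ℝ :=
  ((Nat.card F : ℝ) ^ P.natDegree)⁻¹

/-- From `log ((1 + x) / (1 - x)) ≥ 2x` at `x = 1 / (2d)`. The right side is chosen so that its
product over `d` telescopes. -/
theorem Real.exp_one_div_le {d : ℕ} (hd : 1 ≤ d) :
    Real.exp (1 / (d : ℝ)) ≤ (2 * d + 1) / (2 * d - 1) := by
  have hd' : (1 : ℝ) ≤ d := by exact_mod_cast hd
  have hx1 : (1 : ℝ) / (2 * d) < 1 := by rw [div_lt_one (by linarith)]; linarith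
  have h := Real.sum_range_le_log_div (x := 1 / (2 * d : ℝ)) (by positivity) hx1 1
  have e : (1 + 1 / (2 * d : ℝ)) / (1 - 1 / (2 * d)) = (2 * d + 1) / (2 * d - 1) := by
    have : (2 * d - 1 : ℝ) ≠ 0 := by linarith
    have h2 : (1 - 1 / (2 * d) : ℝ) ≠ 0 := by linarith
    field_simp
  rw [e] at h
  rw [← Real.le_log_iff_exp_le (div_pos (by linarith) (by linarith))]
  have e2 : (1 : ℝ) / d = 2 * (1 / (2 * d)) := by field_simp
  norm_num at h ⊢
  rw [← one_div, e2]
  norm_num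
  linarith

/-- Bernoulli's inequality with real exponent `q / 2 ≥ 1` bounds the square root below by `1 / 2`;
equality holds at `q = 2`. -/
theorem one_sub_inv_pow_ge {q : ℕ} (hq : 2 ≤ q) : (1 / 4 : ℝ) ≤ (1 - (q : ℝ)⁻¹) ^ q := by
  have hq' : (2 : ℝ) ≤ q := by exact_mod_cast hq
  have hi : (q : ℝ)⁻¹ ≤ 1 / 2 := by
    rw [one_div]; exact inv_anti₀ two_pos hq'
  have h := one_add_mul_self_le_rpow_one_add (s := -(q : ℝ)⁻¹) (by linarith)
    (p := (q : ℝ) / 2) (by linarith)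
  have e : 1 + (q : ℝ) / 2 * -(q : ℝ)⁻¹ = 1 / 2 := by field_simp; norm_num
  rw [e, ← sub_eq_add_neg] at h
  have e2 : (1 - (q : ℝ)⁻¹) ^ q = ((1 - (q : ℝ)⁻¹) ^ ((q : ℝ) / 2)) ^ 2 := by
    rw [← Real.rpow_natCast _ 2, ← Real.rpow_mul (by linarith), ← Real.rpow_natCast]
    congr 1; push_cast; ring
  rw [e2]
  nlinarith

section
variable {F : Type*} [Field F] [Finite F]

theorem two_le_natCard : (2 : ℝ) ≤ Nat.card F := by exact_mod_cast Finite.one_lt_card (α := F)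

theorem invNorm_pos (P : F[X]) : 0 < invNorm P := by
  have := two_le_natCard (F := F)
  unfold invNorm; positivity

theorem invNorm_le_half {P : F[X]} (hP : P.natDegree ≠ 0) : invNorm P ≤ 1 / 2 := by
  have := two_le_natCard (F := F)
  rw [invNorm, one_div]
  apply inv_anti₀ two_pos
  exact this.trans (le_self_pow₀ (by linarith) hP)

theorem inv_one_sub_invNorm_pos {P : F[X]} (hP : P.natDegree ≠ 0) :
    1 < (1 - invNorm P)⁻¹ := by
  have h1 := invNorm_le_half hP
  have h2 := invNorm_pos P
  rw [one_lt_inv₀ (by linarith)]; linarith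

theorem inv_one_sub_invNorm_le {P : F[X]} (hP : P.natDegree ≠ 0) :
    (1 - invNorm P)⁻¹ ≤ Real.exp (1 / ((Nat.card F : ℝ) ^ P.natDegree - 1)) := by
  have h2 := invNorm_pos P
  have h1 := invNorm_le_half hP
  have hy : 2 ≤ (Nat.card F : ℝ) ^ P.natDegree := by
    have := two_le_natCard (F := F)
    exact this.trans (le_self_pow₀ (by linarith) hP)
  refine le_trans (le_of_eq ?_) (Real.add_one_le_exp _)
  unfold invNorm
  have : (Nat.card F : ℝ) ^ P.natDegree - 1 ≠ 0 := by linarith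
  field_simp
  ring

theorem prod_irredsOfDegree_one_le :
    ∏ P ∈ irredsOfDegree F 1, (1 - invNorm P)⁻¹ ≤ 4 := by
  have hq : 2 ≤ Nat.card F := Finite.one_lt_card (α := F)
  rw [Finset.prod_congr rfl (g := fun _ => (1 - (Nat.card F : ℝ)⁻¹)⁻¹), Finset.prod_const,
    card_irredsOfDegree_one, inv_pow]
  · rw [show (4 : ℝ) = (1 / 4)⁻¹ by norm_num]
    exact inv_anti₀ (by norm_num) (one_sub_inv_pow_ge hq)
  · intro P hP
    rw [invNorm, (mem_irredsOfDegree.1 hP).1.2, pow_one]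

theorem prod_irredsOfDegree_le {d : ℕ} (hd : 2 ≤ d) :
    ∏ P ∈ irredsOfDegree F d, (1 - invNorm P)⁻¹ ≤ (2 * d + 1) / (2 * d - 1) := by
  refine le_trans ?_ (Real.exp_one_div_le (by omega))
  have hq := two_le_natCard (F := F)
  have hy : 2 ≤ (Nat.card F : ℝ) ^ d := hq.trans (le_self_pow₀ (by linarith) (by omega))
  have hd' : (0 : ℝ) < d := by exact_mod_cast (by omega : 0 < d)
  calc ∏ P ∈ irredsOfDegree F d, (1 - invNorm P)⁻¹
      ≤ ∏ P ∈ irredsOfDegree F d, Real.exp (1 / ((Nat.card F : ℝ) ^ d - 1)) := by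
        refine Finset.prod_le_prod (fun P hP => ?_) (fun P hP => ?_)
        all_goals
          have h := (mem_irredsOfDegree.1 hP).1.2
        · exact zero_le_one.trans (inv_one_sub_invNorm_pos (by omega)).le
        · have := inv_one_sub_invNorm_le (P := P) (by omega)
          rwa [h] at this
    _ = Real.exp ((irredsOfDegree F d).card * (1 / ((Nat.card F : ℝ) ^ d - 1))) := by
        rw [Finset.prod_const, ← Real.exp_nat_mul]
    _ ≤ _ := by
        rw [Real.exp_le_exp, mul_one_div, div_le_div_iff₀ (by linarith) hd']
        have h : ((d * (irredsOfDegree F d).card + Nat.card F : ℕ) : ℝ) ≤ ((Nat.card F ^ d : ℕ) : ℝ) := by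
          exact_mod_cast mul_card_irredsOfDegree_add_le hd
        push_cast at h
        linarith

/-- Explicit upper bound in Mertens' theorem. -/
theorem prod_Icc_irredsOfDegree_le {m : ℕ} (hm : 1 ≤ m) :
    ∏ d ∈ Finset.Icc 1 m, ∏ P ∈ irredsOfDegree F d, (1 - invNorm P)⁻¹ ≤ 4 / 3 * (2 * m + 1) := by
  induction m, hm using Nat.le_induction with
  | base =>
    -- The factor `4` from degree one equals `4/3 * (2 * 1 + 1)`, which fixes the constant `4/3`;
    -- the later factors telescope.
    have := prod_irredsOfDegree_one_le (F := F)
    rw [Finset.Icc_self, Finset.prod_singleton]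
    norm_num only [Nat.cast_one]
    exact this
  | succ m hm ih =>
    rw [Finset.prod_Icc_succ_top (by omega)]
    have h := prod_irredsOfDegree_le (F := F) (d := m + 1) (by omega)
    have hm' : (1 : ℝ) ≤ m := by exact_mod_cast hm
    refine (mul_le_mul ih h (Finset.prod_nonneg fun P hP => ?_) (by positivity)).trans ?_
    · have h := (mem_irredsOfDegree.1 hP).1.2
      exact zero_le_one.trans (inv_one_sub_invNorm_pos (by omega)).le
    · push_cast
      have : (2 * ((m : ℝ) + 1) - 1) = 2 * m + 1 := by ring
      rw [this]
      apply le_of_eq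
      field_simp

/-- Primes of degree at most `m` are covered by the Mertens bound. The others number at most
`(2^(m+1) - 1) / (m + 1)`, and each factor is at most `exp (1 / (2^(m+1) - 1))`; together they
contribute at most `exp (1 / (m + 1))`, one more telescoping factor. -/
theorem prod_inv_one_sub_invNorm_le {S : Finset F[X]} (hS : ∀ P ∈ S, P.Monic ∧ Irreducible P)
    {m : ℕ} (hm : 1 ≤ m) (hD : ∑ P ∈ S, P.natDegree < 2 ^ (m + 1)) :
    ∏ P ∈ S, (1 - invNorm P)⁻¹ ≤ 4 / 3 * (2 * m + 3) := by
  classical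
  have hdeg : ∀ P ∈ S, P.natDegree ≠ 0 := fun P hP => (hS P hP).2.natDegree_pos.ne'
  have hm' : (1 : ℝ) ≤ m := by exact_mod_cast hm
  rw [← Finset.prod_filter_mul_prod_filter_not S (fun P => P.natDegree ≤ m)]
  have h1 : ∏ P ∈ S with P.natDegree ≤ m, (1 - invNorm P)⁻¹ ≤ 4 / 3 * (2 * m + 1) := by
    refine le_trans ?_ (prod_Icc_irredsOfDegree_le (F := F) hm)
    rw [← Finset.prod_biUnion]
    · refine Finset.prod_le_prod_of_subset_of_one_le (fun P hP => ?_) (fun P hP => ?_)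
        (fun P hP _ => ?_)
      · obtain ⟨hP, hPm⟩ := Finset.mem_filter.1 hP
        exact Finset.mem_biUnion.2 ⟨P.natDegree, Finset.mem_Icc.2 ⟨(hS P hP).2.natDegree_pos, hPm⟩,
          mem_irredsOfDegree.2 ⟨⟨(hS P hP).1, rfl⟩, (hS P hP).2⟩⟩
      · exact zero_le_one.trans (inv_one_sub_invNorm_pos (hdeg P (Finset.mem_filter.1 hP).1)).le
      · obtain ⟨d, hd, hP⟩ := Finset.mem_biUnion.1 hP
        exact (inv_one_sub_invNorm_pos (mem_irredsOfDegree.1 hP).2.natDegree_pos.ne').le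
    · intro i _ j _ hij
      rw [Function.onFun, Finset.disjoint_left]
      intro P h1 h2
      exact hij ((mem_irredsOfDegree.1 h1).1.2.symm.trans (mem_irredsOfDegree.1 h2).1.2)
  have h2 : ∏ P ∈ S with ¬ P.natDegree ≤ m, (1 - invNorm P)⁻¹ ≤
      (2 * (m + 1 : ℕ) + 1) / (2 * (m + 1 : ℕ) - 1) := by
    refine le_trans ?_ (Real.exp_one_div_le (by omega))
    set B := S.filter (fun P => ¬ P.natDegree ≤ m) with hB
    have hcard : (m + 1) * B.card + 1 ≤ 2 ^ (m + 1) := by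
      refine lt_of_le_of_lt ?_ hD
      calc (m + 1) * B.card = ∑ P ∈ B, (m + 1) := by simp [mul_comm]
        _ ≤ ∑ P ∈ B, P.natDegree := Finset.sum_le_sum fun P hP => by
            have := (Finset.mem_filter.1 hP).2; omega
        _ ≤ _ := Finset.sum_le_sum_of_subset (Finset.filter_subset _ _)
    have hcard' : ((m + 1 : ℕ) * B.card + 1 : ℝ) ≤ 2 ^ (m + 1) := by exact_mod_cast hcard
    have hy : (2 : ℝ) ≤ 2 ^ (m + 1) := le_self_pow₀ (by norm_num) (by omega)
    calc ∏ P ∈ B, (1 - invNorm P)⁻¹ ≤ ∏ P ∈ B, Real.exp (1 / ((2 : ℝ) ^ (m + 1) - 1)) := by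
          refine Finset.prod_le_prod (fun P hP => ?_) (fun P hP => ?_)
          all_goals
            have h := Finset.mem_filter.1 hP
          · exact zero_le_one.trans (inv_one_sub_invNorm_pos (hdeg P h.1)).le
          · refine (inv_one_sub_invNorm_le (hdeg P h.1)).trans ?_
            have h3 : (2 : ℝ) ^ (m + 1) ≤ (Nat.card F : ℝ) ^ P.natDegree :=
              (pow_le_pow_left₀ (by norm_num) two_le_natCard _).trans
                (pow_le_pow_right₀ (by linarith [two_le_natCard (F := F)]) (by omega))
            gcongr
            linarith
      _ = Real.exp (B.card * (1 / ((2 : ℝ) ^ (m + 1) - 1))) := by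
          rw [Finset.prod_const, ← Real.exp_nat_mul]
      _ ≤ _ := by
          rw [Real.exp_le_exp, mul_one_div, div_le_div_iff₀ (by linarith) (by positivity)]
          linarith
  refine (mul_le_mul h1 h2 (Finset.prod_nonneg fun P hP => ?_) (by positivity)).trans ?_
  · exact zero_le_one.trans (inv_one_sub_invNorm_pos (hdeg P (Finset.mem_filter.1 hP).1)).le
  · push_cast
    have : (2 * ((m : ℝ) + 1) - 1) = 2 * m + 1 := by ring
    rw [this]
    apply le_of_eq
    field_simp
    ring

end

/-! ### Exact equidistribution of monic polynomials modulo primes. -/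

section
variable {F : Type*} [Field F] [Finite F]

theorem sum_monicsOfDegree_eq_sum_degreeLT (n : ℕ) [Fintype (degreeLT F n)] (f : F[X] → ℝ) :
    ∑ h ∈ monicsOfDegree F n, f h = ∑ v : degreeLT F n, f (X ^ n + v.1) := by
  refine (Finset.sum_bij (fun v _ => X ^ n + v.1) (fun v _ => ?_) (fun v _ w _ h => ?_)
    (fun h hh => ?_) (fun v _ => rfl)).symm
  · exact mem_monicsOfDegree.2 ((monicEquivDegreeLT n).symm v).2
  · exact Subtype.ext (add_left_cancel h)
  · have := mem_monicsOfDegree.1 hh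
    exact ⟨monicEquivDegreeLT n ⟨h, this⟩, Finset.mem_univ _,
      congrArg Subtype.val ((monicEquivDegreeLT n).symm_apply_apply ⟨h, this⟩)⟩

theorem natCard_quotient_span {P : F[X]} (hP : P ≠ 0) :
    Finite (F[X] ⧸ Ideal.span {P}) ∧
    Nat.card (F[X] ⧸ Ideal.span {P}) = Nat.card F ^ P.natDegree := by
  have : Module.Finite F (F[X] ⧸ Ideal.span {P}) := (AdjoinRoot.powerBasis hP).finite
  refine ⟨Module.finite_of_finite F, ?_⟩
  rw [Module.natCard_eq_pow_finrank (K := F), finrank_quotient_span_eq_natDegree]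

theorem AddMonoidHom.sum_comp_of_surjective {V W : Type*} [AddGroup V] [AddGroup W] [Fintype V]
    [Fintype W] (T : V →+ W) (hT : Function.Surjective T) (G : W → ℝ) :
    (Fintype.card W : ℝ) * ∑ v, G (T v) = Fintype.card V * ∑ w, G w := by
  classical
  have hc : ∀ w, (Finset.univ.filter (fun v => T v = w)).card =
      (Finset.univ.filter (fun v => T v = 0)).card := fun w =>
    AddMonoidHom.card_fiber_eq_of_mem_range T (hT w) (hT 0)
  have hsum : ∀ G : W → ℝ, ∑ v, G (T v) =
      (Finset.univ.filter (fun v => T v = 0)).card * ∑ w, G w := by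
    intro G
    rw [← Finset.sum_fiberwise Finset.univ T, Finset.mul_sum]
    refine Finset.sum_congr rfl fun w _ => ?_
    rw [Finset.sum_congr rfl (g := fun _ => G w), Finset.sum_const, hc, nsmul_eq_mul]
    intro v hv
    rw [(Finset.mem_filter.1 hv).2]
  have h1 := hsum (fun _ => 1)
  simp only [Finset.sum_const, Finset.card_univ, nsmul_eq_mul, mul_one] at h1
  rw [hsum, h1]
  ring

omit [Finite F] in
theorem isCoprime_of_monic_irreducible {P Q : F[X]} (hP : P.Monic ∧ Irreducible P)
    (hQ : Q.Monic ∧ Irreducible Q) (h : P ≠ Q) : IsCoprime P Q := by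
  rw [hP.2.coprime_iff_not_dvd]
  intro hd
  exact h (eq_of_monic_of_associated hP.1 hQ.1 (hP.2.associated_of_dvd hQ.2 hd))

/-- Residues modulo distinct primes of total degree at most `n` are independent and uniformly
distributed over the monic polynomials of degree `n`. -/
theorem sum_monicsOfDegree_prod_quotient {A : Finset F[X]}
    (hA : ∀ P ∈ A, P.Monic ∧ Irreducible P) {n : ℕ} (hn : ∑ P ∈ A, P.natDegree ≤ n)
    (φ : ∀ P : F[X], F[X] ⧸ Ideal.span {P} → ℝ) :
    ∑ h ∈ monicsOfDegree F n, ∏ P ∈ A, φ P (Ideal.Quotient.mk _ h) =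
      (Nat.card F : ℝ) ^ n * ∏ P ∈ A, (invNorm P * ∑ᶠ x, φ P x) := by
  classical
  have : ∀ P : A, Fintype (F[X] ⧸ Ideal.span {P.1}) := fun P =>
    have := (natCard_quotient_span (hA P.1 P.2).1.ne_zero).1; Fintype.ofFinite _
  have : Finite (degreeLT F n) := Finite.of_equiv _ (degreeLTEquiv F n).toEquiv.symm
  have := Fintype.ofFinite (degreeLT F n)
  -- Reduction modulo all primes of `A` is additive on polynomials of degree below `n`, and
  -- surjective by the Chinese remainder theorem, so all its fibres have the same size. The monics
  -- are the translate by `X^n`.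
  let T : degreeLT F n →+ ∀ P : A, F[X] ⧸ Ideal.span {P.1} :=
    (RingHom.pi fun P : A => Ideal.Quotient.mk (Ideal.span {P.1})).toAddMonoidHom.comp
      (degreeLT F n).subtype.toAddMonoidHom
  have hTapp : ∀ v P, T v P = Ideal.Quotient.mk _ v.1 := fun v P => rfl
  have hcop : Pairwise (Function.onFun IsCoprime fun P : A => Ideal.span {P.1}) := by
    intro P Q hPQ
    rw [Function.onFun, Ideal.isCoprime_span_singleton_iff]
    exact isCoprime_of_monic_irreducible (hA _ P.2) (hA _ Q.2) (fun h => hPQ (Subtype.ext h))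
  have hmon : (∏ P ∈ A, P).Monic := monic_prod_of_monic _ _ fun P hP => (hA P hP).1
  have hT : Function.Surjective T := by
    intro w
    obtain ⟨f, hf⟩ := Ideal.pi_quotient_surjective hcop w
    refine ⟨⟨f %ₘ ∏ P ∈ A, P, ?_⟩, ?_⟩
    · rw [mem_degreeLT]
      refine (degree_modByMonic_lt _ hmon).trans_le ?_
      rw [degree_eq_natDegree hmon.ne_zero, natDegree_prod_of_monic _ _ fun P hP => (hA P hP).1]
      exact_mod_cast hn
    · funext P
      rw [hTapp, ← hf P, Ideal.Quotient.eq, Ideal.mem_span_singleton]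
      change P.1 ∣ f %ₘ (∏ P ∈ A, P) - f
      rw [modByMonic_eq_sub_mul_div, sub_sub_cancel_left, dvd_neg]
      exact (Finset.dvd_prod_of_mem (fun P => P) P.2).mul_right _
  have hcardW : (Fintype.card (∀ P : A, F[X] ⧸ Ideal.span {P.1}) : ℝ) =
      ∏ P : A, (invNorm P.1)⁻¹ := by
    rw [Fintype.card_pi]
    push_cast
    refine Finset.prod_congr rfl fun P _ => ?_
    rw [Fintype.card_eq_nat_card, (natCard_quotient_span (hA _ P.2).1.ne_zero).2, invNorm, inv_inv]
    push_cast; rfl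
  have hcardV : (Fintype.card (degreeLT F n) : ℝ) = (Nat.card F : ℝ) ^ n := by
    rw [Fintype.card_eq_nat_card, Nat.card_congr (degreeLTEquiv F n).toEquiv, Nat.card_fun,
      Nat.card_eq_fintype_card (α := Fin n), Fintype.card_fin]
    push_cast; rfl
  have key := T.sum_comp_of_surjective hT
    (fun w => ∏ P : A, φ P.1 (Ideal.Quotient.mk _ (X ^ n) + w P))
  rw [hcardW, hcardV] at key
  rw [sum_monicsOfDegree_eq_sum_degreeLT]
  have e1 : ∀ v : degreeLT F n, ∏ P ∈ A, φ P (Ideal.Quotient.mk _ (X ^ n + v.1)) =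
      ∏ P : A, φ P.1 (Ideal.Quotient.mk _ (X ^ n) + T v P) := by
    intro v
    rw [← Finset.prod_coe_sort]
    refine Finset.prod_congr rfl fun P _ => ?_
    rw [hTapp, map_add]
  have e2 : ∑ w : ∀ P : A, F[X] ⧸ Ideal.span {P.1},
      ∏ P : A, φ P.1 (Ideal.Quotient.mk _ (X ^ n) + w P) = ∏ P : A, ∑ x, φ P.1 x := by
    rw [← Fintype.piFinset_univ, ← Finset.prod_univ_sum (fun _ => Finset.univ)
      (fun (P : A) x => φ P.1 (Ideal.Quotient.mk _ (X ^ n) + x))]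
    refine Finset.prod_congr rfl fun P _ => ?_
    exact Fintype.sum_equiv (Equiv.addLeft (Ideal.Quotient.mk _ (X ^ n))) _ _ (fun _ => rfl)
  rw [Finset.sum_congr rfl fun v _ => e1 v, ← Finset.prod_coe_sort A, Finset.prod_mul_distrib,
    Finset.prod_congr rfl fun (P : A) _ => finsum_eq_sum_of_fintype (φ P.1)]
  rw [e2, Finset.prod_inv_distrib] at key
  have hne : ∏ P : A, invNorm P.1 ≠ 0 := Finset.prod_ne_zero_iff.2 fun P _ => (invNorm_pos P.1).ne'
  field_simp at key
  rw [key]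
  ring

/-- The monic polynomials of degree `deg P` form a complete residue system modulo `P`, so the
quotient rings can be dropped. The case `A = {P}`, `n = deg P` of the previous identity supplies
this. -/
theorem sum_monicsOfDegree_prod {A : Finset F[X]}
    (hA : ∀ P ∈ A, P.Monic ∧ Irreducible P) {n : ℕ} (hn : ∑ P ∈ A, P.natDegree ≤ n)
    {φ : F[X] → F[X] → ℝ} (hφ : ∀ P ∈ A, ∀ f g, P ∣ f - g → φ P f = φ P g) :
    ∑ h ∈ monicsOfDegree F n, ∏ P ∈ A, φ P h =
      (Nat.card F : ℝ) ^ n *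
        ∏ P ∈ A, (invNorm P * ∑ r ∈ monicsOfDegree F P.natDegree, φ P r) := by
  let φ' : ∀ P : F[X], F[X] ⧸ Ideal.span {P} → ℝ := fun P x => φ P x.out
  have hφ' : ∀ P ∈ A, ∀ h, φ P h = φ' P (Ideal.Quotient.mk _ h) := by
    intro P hP h
    apply hφ P hP
    rw [← Ideal.mem_span_singleton, ← Ideal.Quotient.eq]
    exact (Quotient.out_eq _).symm
  have hsingle : ∀ P ∈ A, ∑ r ∈ monicsOfDegree F P.natDegree, φ P r = ∑ᶠ x, φ' P x := by
    intro P hP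
    have h := sum_monicsOfDegree_prod_quotient (A := {P}) (n := P.natDegree)
      (by simpa using hA P hP) (by simp) φ'
    simp only [Finset.prod_singleton] at h
    have hne : (Nat.card F : ℝ) ^ P.natDegree * invNorm P = 1 := by
      rw [invNorm]
      have := two_le_natCard (F := F)
      exact mul_inv_cancel₀ (by positivity)
    rw [Finset.sum_congr rfl fun r _ => hφ' P hP r, h, ← mul_assoc, hne, one_mul]
  rw [Finset.prod_congr rfl fun P hP => congrArg _ (hsingle P hP),
    ← sum_monicsOfDegree_prod_quotient hA hn φ']
  exact Finset.sum_congr rfl fun h _ => Finset.prod_congr rfl fun P hP => hφ' P hP h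

end

/-! ### The large sieve. -/

section
variable {F : Type*} [Field F] [Finite F]

theorem Finset.prod_mul_prod_eq_prod_union {ι R : Type*} [DecidableEq ι] [CommSemiring R]
    (A B : Finset ι) (f g : ι → R) :
    (∏ i ∈ A, f i) * ∏ i ∈ B, g i =
      ∏ i ∈ A ∪ B, ((if i ∈ A then f i else 1) * if i ∈ B then g i else 1) := by
  rw [Finset.prod_mul_distrib, Finset.prod_ite_mem, Finset.prod_ite_mem,
    Finset.union_inter_cancel_left, Finset.union_inter_cancel_right]

/-- An exact form of the large sieve (in its dual form) for polynomials over a finite field. -/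
theorem card_sifted_mul_le {I : Finset F[X]} (hI : ∀ P ∈ I, P.Monic ∧ Irreducible P)
    {n m : ℕ} (hmn : 2 * m ≤ n) (bad : F[X] → F[X] → Prop) [∀ P h, Decidable (bad P h)]
    (hbad : ∀ P ∈ I, ∀ f g, P ∣ f - g → bad P f → bad P g) (w : F[X] → ℕ)
    (hw : ∀ P ∈ I, ((monicsOfDegree F P.natDegree).filter (bad P)).card = w P)
    (hw0 : ∀ P ∈ I, 0 < w P) (hw1 : ∀ P ∈ I, w P < Nat.card F ^ P.natDegree) :
    (((monicsOfDegree F n).filter (fun h => ∀ P ∈ I, ¬ bad P h)).card : ℝ) *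
      ∑ A ∈ I.powerset with ∑ P ∈ A, P.natDegree ≤ m,
        ∏ P ∈ A, ((w P : ℝ) / ((Nat.card F : ℝ) ^ P.natDegree - w P)) ≤ (Nat.card F : ℝ) ^ n := by
  classical
  set fam := I.powerset.filter (fun A => ∑ P ∈ A, P.natDegree ≤ m) with h_fam
  set g : F[X] → ℝ := fun P => (w P : ℝ) / ((Nat.card F : ℝ) ^ P.natDegree - w P) with hg
  -- The value on bad residues is chosen so that `ψ P` has mean zero modulo `P` while being `1` on
  -- good residues; its mean square is then `(g P)⁻¹`.
  set ψ : F[X] → F[X] → ℝ := fun P h => if bad P h then -(g P)⁻¹ else 1 with hψ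
  have hg0 : ∀ P ∈ I, 0 < g P := by
    intro P hP
    have h1 : (w P : ℝ) < (Nat.card F : ℝ) ^ P.natDegree := by exact_mod_cast hw1 P hP
    have h0 : (0 : ℝ) < w P := by exact_mod_cast hw0 P hP
    exact div_pos h0 (by linarith)
  have hper : ∀ P ∈ I, ∀ f g, P ∣ f - g → ψ P f = ψ P g := by
    intro P hP f g hfg
    have : bad P f ↔ bad P g :=
      ⟨hbad P hP f g hfg, hbad P hP g f (by rw [← neg_sub, dvd_neg]; exact hfg)⟩
    simp only [hψ, this]
  have hmean : ∀ P ∈ I, ∀ x : ℝ, ∑ r ∈ monicsOfDegree F P.natDegree, (if bad P r then x else 1) =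
      w P * x + ((Nat.card F : ℝ) ^ P.natDegree - w P) := by
    intro P hP x
    have hc := Finset.card_filter_add_card_filter_not (s := monicsOfDegree F P.natDegree) (bad P)
    rw [hw P hP, card_monicsOfDegree] at hc
    have hc' : (w P : ℝ) + (((monicsOfDegree F P.natDegree).filter (fun r => ¬ bad P r)).card : ℝ)
      = (Nat.card F : ℝ) ^ P.natDegree := by exact_mod_cast hc
    rw [Finset.sum_ite, Finset.sum_const, Finset.sum_const, hw P hP, nsmul_eq_mul, nsmul_eq_mul]
    linarith
  have hmean1 : ∀ P ∈ I, ∑ r ∈ monicsOfDegree F P.natDegree, ψ P r = 0 := by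
    intro P hP
    have h1 : (w P : ℝ) < (Nat.card F : ℝ) ^ P.natDegree := by exact_mod_cast hw1 P hP
    have h0 : (0 : ℝ) < w P := by exact_mod_cast hw0 P hP
    rw [hmean P hP, hg, inv_div]
    field_simp
    ring
  have hmean2 : ∀ P ∈ I, invNorm P * ∑ r ∈ monicsOfDegree F P.natDegree, ψ P r * ψ P r =
      (g P)⁻¹ := by
    intro P hP
    have h1 : (w P : ℝ) < (Nat.card F : ℝ) ^ P.natDegree := by exact_mod_cast hw1 P hP
    have h0 : (0 : ℝ) < w P := by exact_mod_cast hw0 P hP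
    have e : ∀ r, ψ P r * ψ P r = if bad P r then (g P)⁻¹ * (g P)⁻¹ else 1 := by
      intro r; simp only [hψ]; split_ifs <;> ring
    rw [Finset.sum_congr rfl fun r _ => e r, hmean P hP, invNorm, hg, inv_div]
    have h2 : (Nat.card F : ℝ) ^ P.natDegree ≠ 0 := by linarith
    field_simp
    ring
  -- If `A ≠ B`, a prime in exactly one of them contributes a factor of mean zero. Since `2 * m ≤
  -- n`, the total degree of `A ∪ B` is at most `n`, so equidistribution is exact and there is no
  -- error term.
  have horth : ∀ A ∈ fam, ∀ B ∈ fam, ∑ h ∈ monicsOfDegree F n, (∏ P ∈ A, ψ P h) * ∏ P ∈ B, ψ P h =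
      if A = B then (Nat.card F : ℝ) ^ n * (∏ P ∈ A, g P)⁻¹ else 0 := by
    intro A hA B hB
    obtain ⟨hA1, hA2⟩ := Finset.mem_filter.1 hA
    obtain ⟨hB1, hB2⟩ := Finset.mem_filter.1 hB
    have hU : A ∪ B ⊆ I := Finset.union_subset (Finset.mem_powerset.1 hA1) (Finset.mem_powerset.1 hB1)
    simp only [Finset.prod_mul_prod_eq_prod_union A B]
    rw [sum_monicsOfDegree_prod (fun P hP => hI P (hU hP))
      (φ := fun P h => (if P ∈ A then ψ P h else 1) * if P ∈ B then ψ P h else 1)]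
    · split_ifs with hAB
      · subst hAB
        rw [Finset.union_self, ← Finset.prod_inv_distrib]
        congr 1
        refine Finset.prod_congr rfl fun P hP => ?_
        simp only [if_pos hP]
        exact hmean2 P (hU (by simpa using hP))
      · have : ∃ P ∈ A ∪ B, ¬ (P ∈ A ↔ P ∈ B) := by
          by_contra! h
          apply hAB
          ext P
          by_cases hP : P ∈ A ∪ B
          · exact h P hP
          · simp only [Finset.mem_union, not_or] at hP
            tauto
        obtain ⟨P, hP, hne⟩ := this
        rw [Finset.prod_eq_zero hP, mul_zero]
        have h0 := hmean1 P (hU hP)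
        by_cases hPA : P ∈ A
        · have hPB : P ∉ B := by tauto
          simp only [if_pos hPA, if_neg hPB, mul_one, h0, mul_zero]
        · have hPB : P ∈ B := by tauto
          simp only [if_neg hPA, if_pos hPB, one_mul, h0, mul_zero]
    · refine le_trans ?_ hmn
      rw [two_mul]
      refine le_trans ?_ (add_le_add hA2 hB2)
      rw [← Finset.sum_union_inter]
      exact Nat.le_add_right _ _
    · intro P hP f g hfg
      simp only [hper P (hU hP) f g hfg]
  set L : ℝ := ∑ A ∈ fam, ∏ P ∈ A, g P with hL
  have hgA : ∀ A ∈ fam, 0 < ∏ P ∈ A, g P := fun A hA => Finset.prod_pos fun P hP =>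
    hg0 P (Finset.mem_powerset.1 (Finset.mem_filter.1 hA).1 hP)
  have hLpos : 0 < L := Finset.sum_pos hgA ⟨∅, by simp [h_fam]⟩
  have htotal : ∑ h ∈ monicsOfDegree F n, (∑ A ∈ fam, (∏ P ∈ A, g P) * ∏ P ∈ A, ψ P h) ^ 2 =
      (Nat.card F : ℝ) ^ n * L := by
    calc _ = ∑ A ∈ fam, ∑ B ∈ fam, (∏ P ∈ A, g P) * (∏ P ∈ B, g P) *
          ∑ h ∈ monicsOfDegree F n, (∏ P ∈ A, ψ P h) * ∏ P ∈ B, ψ P h := by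
          rw [Finset.sum_congr rfl fun h _ => by rw [sq, Finset.sum_mul_sum], Finset.sum_comm]
          refine Finset.sum_congr rfl fun A _ => ?_
          rw [Finset.sum_comm]
          refine Finset.sum_congr rfl fun B _ => ?_
          rw [Finset.mul_sum]
          refine Finset.sum_congr rfl fun h _ => ?_
          ring
      _ = ∑ A ∈ fam, (Nat.card F : ℝ) ^ n * ∏ P ∈ A, g P := by
          refine Finset.sum_congr rfl fun A hA => ?_
          rw [Finset.sum_congr rfl fun B hB => by rw [horth A hA B hB]]
          simp only [mul_ite, mul_zero]
          rw [Finset.sum_ite_eq, if_pos hA]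
          have := (hgA A hA).ne'
          field_simp
      _ = _ := by rw [Finset.mul_sum]
  -- At a sifted `h` every `ψ P h` is `1`, so the squared inner sum is `L ^ 2`.
  have hlow : (((monicsOfDegree F n).filter (fun h => ∀ P ∈ I, ¬ bad P h)).card : ℝ) * L ^ 2 ≤
      (Nat.card F : ℝ) ^ n * L := by
    rw [← htotal, ← nsmul_eq_mul, ← Finset.sum_const]
    refine le_trans (le_of_eq (Finset.sum_congr rfl fun h hh => ?_))
      (Finset.sum_le_sum_of_subset_of_nonneg (Finset.filter_subset _ _) fun _ _ _ => sq_nonneg _)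
    congr 1
    refine Finset.sum_congr rfl fun A hA => ?_
    symm
    convert mul_one _
    refine Finset.prod_eq_one fun P hP => ?_
    have hP' := Finset.mem_powerset.1 (Finset.mem_filter.1 hA).1 hP
    simp only [hψ, if_neg ((Finset.mem_filter.1 hh).2 P hP')]
  rw [sq, ← mul_assoc] at hlow
  exact le_of_mul_le_mul_right hlow hLpos

end

/-! ### Lower bound for the sieve sum. -/

/-- The subsets are split by whether they contain `P`. The threshold is an integer because `t - d P`
may be negative. -/
theorem Finset.sum_powerset_insert_le {ι : Type*} [DecidableEq ι] (d : ι → ℕ) (f : ι → ℝ)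
    {I : Finset ι} {P : ι} (hP : P ∉ I) (t : ℤ) :
    ∑ A ∈ (insert P I).powerset with ((∑ i ∈ A, d i : ℕ) : ℤ) ≤ t, ∏ i ∈ A, f i =
      (∑ A ∈ I.powerset with ((∑ i ∈ A, d i : ℕ) : ℤ) ≤ t, ∏ i ∈ A, f i) +
      f P * ∑ A ∈ I.powerset with ((∑ i ∈ A, d i : ℕ) : ℤ) ≤ t - d P, ∏ i ∈ A, f i := by
  have hnot : ∀ A ∈ I.powerset, P ∉ A := fun A hA h => hP (Finset.mem_powerset.1 hA h)
  simp only [Finset.sum_filter]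
  rw [Finset.sum_powerset_insert hP, Finset.mul_sum]
  congr 1
  refine Finset.sum_congr rfl fun A hA => ?_
  rw [Finset.sum_insert (hnot A hA), Finset.prod_insert (hnot A hA), mul_ite, mul_zero]
  congr 1
  push_cast
  exact propext ⟨fun h => by linarith, fun h => by linarith⟩

/-- Truncated Euler products can be compared factor by factor. -/
theorem Finset.sum_powerset_prod_le_prod_mul_sum {ι : Type*} (d : ι → ℕ) (u g c : ι → ℝ)
    (I : Finset ι) (hu : ∀ i ∈ I, 0 ≤ u i) (hg : ∀ i ∈ I, 0 ≤ g i) (hc : ∀ i ∈ I, 1 ≤ c i)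
    (h : ∀ i ∈ I, 1 + u i ≤ c i * (1 + g i)) (t : ℤ) :
    ∑ A ∈ I.powerset with ((∑ i ∈ A, d i : ℕ) : ℤ) ≤ t, ∏ i ∈ A, u i ≤
      (∏ i ∈ I, c i) *
        ∑ A ∈ I.powerset with ((∑ i ∈ A, d i : ℕ) : ℤ) ≤ t, ∏ i ∈ A, g i := by
  classical
  induction I using Finset.induction_on generalizing t with
  | empty => simp only [Finset.powerset_empty, Finset.prod_empty, one_mul, Finset.sum_filter,
      Finset.sum_singleton, le_refl]
  | insert P I hP ih =>
    simp only [Finset.forall_mem_insert] at hu hg hc h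
    have ih := ih hu.2 hg.2 hc.2 h.2
    rw [Finset.sum_powerset_insert_le d u hP, Finset.sum_powerset_insert_le d g hP,
      Finset.prod_insert hP]
    set S : ℤ → ℝ := fun t => ∑ A ∈ I.powerset with ((∑ i ∈ A, d i : ℕ) : ℤ) ≤ t, ∏ i ∈ A, g i
      with hS
    have hmono : S (t - d P) ≤ S t := by
      refine Finset.sum_le_sum_of_subset_of_nonneg ?_ ?_
      · intro A hA
        rw [Finset.mem_filter] at hA ⊢
        exact ⟨hA.1, hA.2.trans (by simp)⟩
      · intro A hA _
        exact Finset.prod_nonneg fun i hi =>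
          hg.2 i (Finset.mem_powerset.1 (Finset.mem_filter.1 hA).1 hi)
    have hS0 : 0 ≤ S (t - d P) := Finset.sum_nonneg fun A hA => Finset.prod_nonneg fun i hi =>
          hg.2 i (Finset.mem_powerset.1 (Finset.mem_filter.1 hA).1 hi)
    have hC : 0 ≤ ∏ i ∈ I, c i := Finset.prod_nonneg fun i hi => zero_le_one.trans (hc.2 i hi)
    refine (add_le_add (ih t) (mul_le_mul_of_nonneg_left (ih (t - d P)) hu.1)).trans ?_
    change (∏ i ∈ I, c i) * S t + u P * ((∏ i ∈ I, c i) * S (t - d P)) ≤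
      c P * (∏ i ∈ I, c i) * (S t + g P * S (t - d P))
    -- The difference of the two sides is `(c - 1) * (S t - S (t - d)) + (c * (1 + g) - (1 + u)) * S
    -- (t - d)`.
    have key : S t + u P * S (t - d P) ≤ c P * (S t + g P * S (t - d P)) := by
      nlinarith [mul_nonneg (sub_nonneg.2 hc.1) (sub_nonneg.2 hmono),
        mul_nonneg (sub_nonneg.2 h.1) hS0]
    nlinarith [mul_le_mul_of_nonneg_left key hC]

/-- The monic irreducible divisors of a polynomial. -/
noncomputable def irredDivisors {F : Type*} [Field F] (a : F[X]) : Finset F[X] :=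
  letI := Classical.decEq F
  UniqueFactorizationMonoid.primeFactors a

theorem mem_irredDivisors {F : Type*} [Field F] {a P : F[X]} (ha : a ≠ 0) :
    P ∈ irredDivisors a ↔ P.Monic ∧ Irreducible P ∧ P ∣ a := by
  let := Classical.decEq F
  exact mem_primeFactors_iff_monic ha

open UniqueFactorizationMonoid in
theorem exists_exponents {F : Type*} [Field F] : ∃ v : F[X] → F[X] → ℕ,
    ∀ f : F[X], f.Monic → ∀ A : Finset F[X], irredDivisors f ⊆ A →
      f = ∏ P ∈ A, P ^ v P f ∧ ∀ P, v P f = 0 ↔ P ∉ irredDivisors f := by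
  classical
  refine ⟨fun P f => (normalizedFactors f).count P, fun f hf A hA => ⟨?_, fun P => ?_⟩⟩
  · have h := prod_normalizedFactors_eq hf.ne_zero
    rw [hf.normalize_eq_self] at h
    conv_lhs => rw [← h]
    refine Finset.prod_multiset_count_of_subset _ _ ?_
    convert hA
    simp only [irredDivisors, primeFactors]
    congr!
  · rw [Multiset.count_eq_zero, irredDivisors, mem_primeFactors]

section
variable {F : Type*} [Field F] [Finite F]

/-- All monic irreducible polynomials of degree at most `m`. -/
noncomputable def irredsUpTo (F : Type*) [Field F] [Finite F] (m : ℕ) : Finset F[X] :=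
  letI := Classical.decEq F[X]
  (Finset.range (m + 1)).biUnion (irredsOfDegree F)

theorem mem_irredsUpTo {m : ℕ} {P : F[X]} :
    P ∈ irredsUpTo F m ↔ (P.Monic ∧ Irreducible P) ∧ P.natDegree ≤ m := by
  classical
  simp only [irredsUpTo, Finset.mem_biUnion, Finset.mem_range, mem_irredsOfDegree]
  constructor
  · rintro ⟨d, hd, ⟨h1, rfl⟩, h2⟩
    exact ⟨⟨h1, h2⟩, by omega⟩
  · rintro ⟨⟨h1, h2⟩, h3⟩
    exact ⟨_, by omega, ⟨h1, rfl⟩, h2⟩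

theorem sum_invNorm_monicsOfDegree (n : ℕ) : ∑ f ∈ monicsOfDegree F n, invNorm f = 1 := by
  have := two_le_natCard (F := F)
  rw [Finset.sum_congr rfl (g := fun _ => ((Nat.card F : ℝ) ^ n)⁻¹), Finset.sum_const,
    card_monicsOfDegree, nsmul_eq_mul]
  · push_cast
    exact mul_inv_cancel₀ (by positivity)
  · intro f hf
    rw [invNorm, (mem_monicsOfDegree.1 hf).2]

omit [Finite F] in
theorem invNorm_prod_pow {A : Finset F[X]} (hA : ∀ P ∈ A, P.Monic ∧ Irreducible P)
    (v : F[X] → ℕ) : invNorm (∏ P ∈ A, P ^ v P) = ∏ P ∈ A, invNorm P ^ v P := by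
  unfold invNorm
  rw [natDegree_prod_of_monic _ _ fun P hP => (hA P hP).1.pow _, ← Finset.prod_pow_eq_pow_sum,
    ← Finset.prod_inv_distrib]
  refine Finset.prod_congr rfl fun P hP => ?_
  rw [(hA P hP).1.natDegree_pow, inv_pow, ← pow_mul, mul_comm]

theorem sum_pow_erase_le {x : ℝ} (hx0 : 0 ≤ x) (hx1 : x < 1) (m : ℕ) :
    ∑ p ∈ (Finset.range (m + 1) ×ˢ Finset.range (m + 1)).erase (0, 0), x ^ p.1 * x ^ p.2 ≤
      ((1 - x)⁻¹) ^ 2 - 1 := by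
  have h : ∑ i ∈ Finset.range (m + 1), x ^ i ≤ (1 - x)⁻¹ := by
    rw [← tsum_geometric_of_lt_one hx0 hx1]
    exact (summable_geometric_of_lt_one hx0 hx1).sum_le_tsum _ (fun i _ => pow_nonneg hx0 i)
  have h0 : 0 ≤ ∑ i ∈ Finset.range (m + 1), x ^ i := Finset.sum_nonneg fun i _ => pow_nonneg hx0 i
  have h1 := Finset.add_sum_erase (Finset.range (m + 1) ×ˢ Finset.range (m + 1))
    (fun p => x ^ p.1 * x ^ p.2) (a := (0, 0)) (by simp)
  rw [Finset.sum_product, ← Finset.sum_mul_sum] at h1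
  simp only [pow_zero, mul_one] at h1
  nlinarith

/-- By unique factorization a pair is a family of exponent pairs indexed by `A`. Each prime of `A`
divides at least one component, so `(0, 0)` never occurs; this is the `- 1` in each factor. The
bound `m` only keeps the exponents in a finite range. -/
theorem sum_invNorm_pairs_le {m : ℕ} {A : Finset F[X]} (hA : ∀ P ∈ A, P.Monic ∧ Irreducible P)
    {T : Finset (F[X] × F[X])}
    (hT : ∀ p ∈ T, p.1.Monic ∧ p.2.Monic ∧ p.1.natDegree ≤ m ∧ p.2.natDegree ≤ m ∧
      irredDivisors (p.1 * p.2) = A) :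
    ∑ p ∈ T, invNorm p.1 * invNorm p.2 ≤ ∏ P ∈ A, (((1 - invNorm P)⁻¹) ^ 2 - 1) := by
  classical
  obtain ⟨v, hv⟩ := exists_exponents (F := F)
  have hsub : ∀ p ∈ T, irredDivisors p.1 ⊆ A ∧ irredDivisors p.2 ⊆ A := by
    intro p hp
    obtain ⟨h1, h2, -, -, h5⟩ := hT p hp
    constructor
    · intro P hP
      rw [← h5, mem_irredDivisors (h1.mul h2).ne_zero]
      obtain ⟨a, b, c⟩ := (mem_irredDivisors h1.ne_zero).1 hP
      exact ⟨a, b, c.mul_right _⟩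
    · intro P hP
      rw [← h5, mem_irredDivisors (h1.mul h2).ne_zero]
      obtain ⟨a, b, c⟩ := (mem_irredDivisors h2.ne_zero).1 hP
      exact ⟨a, b, c.mul_left _⟩
  have hbd : ∀ f : F[X], f.Monic → f.natDegree ≤ m → irredDivisors f ⊆ A → ∀ P ∈ A, v P f ≤ m := by
    intro f hf hfm hfA P hP
    have h1 := (hv f hf A hfA).1
    have h2 : P ^ v P f ∣ f := by
      conv_rhs => rw [h1]
      exact Finset.dvd_prod_of_mem (fun P => P ^ v P f) hP
    have h3 := natDegree_le_of_dvd h2 hf.ne_zero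
    rw [natDegree_pow] at h3
    have h4 := (hA P hP).2.natDegree_pos
    nlinarith
  calc ∑ p ∈ T, invNorm p.1 * invNorm p.2
      = ∑ p ∈ T, ∏ P : A, (invNorm P.1 ^ v P.1 p.1 * invNorm P.1 ^ v P.1 p.2) := by
        refine Finset.sum_congr rfl fun p hp => ?_
        obtain ⟨h1, h2, -, -, -⟩ := hT p hp
        obtain ⟨h3, h4⟩ := hsub p hp
        conv_lhs => rw [(hv p.1 h1 A h3).1, (hv p.2 h2 A h4).1]
        rw [invNorm_prod_pow hA, invNorm_prod_pow hA, ← Finset.prod_mul_distrib,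
          ← Finset.prod_coe_sort]
    _ = ∑ e ∈ T.image (fun p => fun P : A => (v P.1 p.1, v P.1 p.2)),
          ∏ P : A, (invNorm P.1 ^ (e P).1 * invNorm P.1 ^ (e P).2) := by
        rw [Finset.sum_image]
        intro p hp r hr hpr
        obtain ⟨h1, h2, -, -, -⟩ := hT p hp
        obtain ⟨h3, h4⟩ := hsub p hp
        obtain ⟨k1, k2, -, -, -⟩ := hT r hr
        obtain ⟨k3, k4⟩ := hsub r hr
        have hpr' : ∀ P ∈ A, v P p.1 = v P r.1 ∧ v P p.2 = v P r.2 := by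
          intro P hP
          have := congrFun hpr ⟨P, hP⟩
          exact ⟨congrArg Prod.fst this, congrArg Prod.snd this⟩
        ext1
        · rw [(hv p.1 h1 A h3).1, (hv r.1 k1 A k3).1]
          exact Finset.prod_congr rfl fun P hP => by rw [(hpr' P hP).1]
        · rw [(hv p.2 h2 A h4).1, (hv r.2 k2 A k4).1]
          exact Finset.prod_congr rfl fun P hP => by rw [(hpr' P hP).2]
    _ ≤ ∑ e ∈ Fintype.piFinset
          (fun _ : A => (Finset.range (m + 1) ×ˢ Finset.range (m + 1)).erase (0, 0)),
          ∏ P : A, (invNorm P.1 ^ (e P).1 * invNorm P.1 ^ (e P).2) := by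
        refine Finset.sum_le_sum_of_subset_of_nonneg ?_ fun e _ _ => Finset.prod_nonneg fun P _ => ?_
        · intro e he
          obtain ⟨p, hp, rfl⟩ := Finset.mem_image.1 he
          obtain ⟨h1, h2, h5, h6, h7⟩ := hT p hp
          obtain ⟨h3, h4⟩ := hsub p hp
          rw [Fintype.mem_piFinset]
          intro P
          have b1 := hbd p.1 h1 h5 h3 P.1 P.2
          have b2 := hbd p.2 h2 h6 h4 P.1 P.2
          simp only [Finset.mem_erase, ne_eq, Prod.mk.injEq, Finset.mem_product, Finset.mem_range]
          refine ⟨?_, by omega, by omega⟩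
          rw [(hv p.1 h1 A h3).2, (hv p.2 h2 A h4).2, mem_irredDivisors h1.ne_zero,
            mem_irredDivisors h2.ne_zero]
          have hPm := hA P.1 P.2
          have hdvd : P.1 ∣ p.1 * p.2 := by
            have : P.1 ∈ irredDivisors (p.1 * p.2) := by rw [h7]; exact P.2
            rw [mem_irredDivisors (h1.mul h2).ne_zero] at this
            exact this.2.2
          rintro ⟨n1, n2⟩
          rcases hPm.2.prime.dvd_or_dvd hdvd with h | h
          · exact n1 ⟨hPm.1, hPm.2, h⟩
          · exact n2 ⟨hPm.1, hPm.2, h⟩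
        · have := invNorm_pos P.1
          positivity
    _ = ∏ P : A, ∑ p ∈ (Finset.range (m + 1) ×ˢ Finset.range (m + 1)).erase (0, 0),
          invNorm P.1 ^ p.1 * invNorm P.1 ^ p.2 := by
        rw [Finset.prod_univ_sum]
    _ ≤ ∏ P : A, (((1 - invNorm P.1)⁻¹) ^ 2 - 1) := by
        refine Finset.prod_le_prod (fun P _ => Finset.sum_nonneg fun p _ => ?_) fun P _ => ?_
        · have := invNorm_pos P.1
          positivity
        · refine sum_pow_erase_le (invNorm_pos P.1).le ?_ m
          exact (invNorm_le_half (hA P.1 P.2).2.natDegree_pos.ne').trans_lt (by norm_num)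
    _ = _ := Finset.prod_coe_sort A (fun P => (((1 - invNorm P)⁻¹) ^ 2 - 1))

/-- The left side is the sum of `1 / (|f₁| |f₂|)` over monic pairs with `deg f₁ + deg f₂ ≤ m`: each
total degree `k` contributes `k + 1`. The pairs are then grouped by the set of primes dividing `f₁ *
f₂`. -/
theorem le_sum_prod_invNorm (m : ℕ) : ((m + 1) * (m + 2) / 2 : ℝ) ≤
    ∑ A ∈ (irredsUpTo F m).powerset with ((∑ P ∈ A, P.natDegree : ℕ) : ℤ) ≤ m,
      ∏ P ∈ A, (((1 - invNorm P)⁻¹) ^ 2 - 1) := by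
  classical
  let T : Finset (F[X] × F[X]) := (Finset.range (m + 1)).biUnion fun k =>
    (Finset.HasAntidiagonal.antidiagonal k).biUnion fun ij => monicsOfDegree F ij.1 ×ˢ monicsOfDegree F ij.2
  have hT : ∀ p : F[X] × F[X], p ∈ T ↔ p.1.Monic ∧ p.2.Monic ∧ p.1.natDegree + p.2.natDegree ≤ m := by
    intro p
    simp only [T, Finset.mem_biUnion, Finset.mem_range, Finset.HasAntidiagonal.mem_antidiagonal,
      Finset.mem_product, mem_monicsOfDegree]
    constructor
    · rintro ⟨k, hk, ⟨i, j⟩, rfl, ⟨h1, rfl⟩, h2, rfl⟩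
      exact ⟨h1, h2, by simpa using Nat.le_of_lt_succ hk⟩
    · rintro ⟨h1, h2, h3⟩
      exact ⟨_, Nat.lt_succ_of_le h3, (p.1.natDegree, p.2.natDegree), rfl, ⟨h1, rfl⟩, h2, rfl⟩
  have hsum : ∑ p ∈ T, invNorm p.1 * invNorm p.2 = ((m + 1) * (m + 2) / 2 : ℝ) := by
    rw [Finset.sum_biUnion]
    · rw [Finset.sum_congr rfl (g := fun k => ((k + 1 : ℕ) : ℝ))]
      · rw [← Nat.cast_sum, eq_div_iff two_ne_zero]
        have := Finset.sum_range_id_mul_two (m + 2)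
        rw [Finset.sum_range_succ'] at this
        simp only [add_zero] at this
        have h2 : (((∑ k ∈ Finset.range (m + 1), (k + 1)) * 2 : ℕ) : ℝ) = (((m + 2) * (m + 2 - 1) : ℕ) : ℝ) := by
          rw [this]
        push_cast at h2 ⊢
        rw [h2]
        ring
      · intro k _
        rw [Finset.sum_biUnion]
        · rw [Finset.sum_congr rfl (g := fun _ => (1 : ℝ))]
          · simp
          · intro ij _
            rw [Finset.sum_product, ← Finset.sum_mul_sum, sum_invNorm_monicsOfDegree,
              sum_invNorm_monicsOfDegree, one_mul]
        · intro a _ b _ hab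
          rw [Function.onFun, Finset.disjoint_left]
          intro p h1 h2
          simp only [Finset.mem_product, mem_monicsOfDegree] at h1 h2
          exact hab (Prod.ext (h1.1.2.symm.trans h2.1.2) (h1.2.2.symm.trans h2.2.2))
    · intro a _ b _ hab
      rw [Function.onFun, Finset.disjoint_left]
      intro p h1 h2
      simp only [Finset.mem_biUnion, Finset.mem_product, mem_monicsOfDegree,
        Finset.HasAntidiagonal.mem_antidiagonal] at h1 h2
      obtain ⟨x, hx, hx1, hx2⟩ := h1
      obtain ⟨y, hy, hy1, hy2⟩ := h2
      omega
  rw [← hsum]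
  rw [← Finset.sum_fiberwise_of_maps_to (s := T) (t := (irredsUpTo F m).powerset.filter
    fun A => ((∑ P ∈ A, P.natDegree : ℕ) : ℤ) ≤ m) (g := fun p => irredDivisors (p.1 * p.2))]
  · refine Finset.sum_le_sum fun A hA => sum_invNorm_pairs_le (m := m) ?_ ?_
    · intro P hP
      exact (mem_irredsUpTo.1 (Finset.mem_powerset.1 (Finset.mem_filter.1 hA).1 hP)).1
    · intro p hp
      obtain ⟨h1, h2⟩ := Finset.mem_filter.1 hp
      obtain ⟨h3, h4, h5⟩ := (hT p).1 h1
      exact ⟨h3, h4, by omega, by omega, h2⟩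
  · intro p hp
    obtain ⟨h3, h4, h5⟩ := (hT p).1 hp
    have h34 := h3.mul h4
    have hd : (p.1 * p.2).natDegree ≤ m := by rwa [h3.natDegree_mul h4]
    rw [Finset.mem_filter, Finset.mem_powerset]
    constructor
    · intro P hP
      obtain ⟨a, b, c⟩ := (mem_irredDivisors h34.ne_zero).1 hP
      exact mem_irredsUpTo.2 ⟨⟨a, b⟩, (natDegree_le_of_dvd c h34.ne_zero).trans hd⟩
    · have : (∑ P ∈ irredDivisors (p.1 * p.2), P.natDegree) ≤ (p.1 * p.2).natDegree := by
        rw [← natDegree_prod_of_monic _ _ fun P hP => ((mem_irredDivisors h34.ne_zero).1 hP).1]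
        refine natDegree_le_of_dvd ?_ h34.ne_zero
        let := Classical.decEq F
        exact UniqueFactorizationMonoid.radical_dvd_self
      exact_mod_cast this.trans hd

end

/-! ### Sieve bound for pairs of irreducibles with given difference. -/

section
variable {F : Type*} [Field F]

/-- The singular factor `∏ (1 - |P|⁻¹)⁻¹` over the monic irreducible divisors `P` of `a`. -/
noncomputable def eulerFactor (a : F[X]) : ℝ :=
  ∏ P ∈ irredDivisors a, (1 - invNorm P)⁻¹

/-- `P + b %ₘ P` serves as the monic representative of degree `deg P` of the class of `b` modulo
`P`. -/
theorem monic_add_modByMonic {P : F[X]} (hP : P.Monic) (b : F[X]) :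
    (P + b %ₘ P).Monic ∧ (P + b %ₘ P).natDegree = P.natDegree := by
  have h := degree_modByMonic_lt b hP
  exact ⟨hP.add_of_left h, natDegree_add_eq_left_of_degree_lt h⟩

theorem dvd_sub_add_modByMonic (P b : F[X]) : P ∣ b - (P + b %ₘ P) := by
  rw [modByMonic_eq_sub_mul_div]
  exact ⟨b /ₘ P - 1, by ring⟩

theorem eq_add_modByMonic {P r b : F[X]} (hP : P.Monic) (hr : r.Monic)
    (hd : r.natDegree = P.natDegree) (h : P ∣ r - b) : r = P + b %ₘ P := by
  obtain ⟨h1, h2⟩ := monic_add_modByMonic hP b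
  have hdvd : P ∣ r - (P + b %ₘ P) := by
    have := dvd_add h (dvd_sub_add_modByMonic P b)
    rwa [sub_add_sub_cancel] at this
  refine sub_eq_zero.1 (eq_zero_of_dvd_of_degree_lt hdvd ?_)
  have hdeg : r.degree = (P + b %ₘ P).degree := by
    rw [degree_eq_natDegree hr.ne_zero, degree_eq_natDegree h1.ne_zero, hd, h2]
  refine (degree_sub_lt_left hdeg hr.ne_zero (hr.leadingCoeff.trans h1.leadingCoeff.symm)).trans_le ?_
  rw [degree_eq_natDegree hr.ne_zero, degree_eq_natDegree hP.ne_zero, hd]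

variable [Finite F]

theorem eulerFactor_pos {a : F[X]} (ha : a ≠ 0) : 0 < eulerFactor a :=
  Finset.prod_pos fun _ hP => zero_lt_one.trans
    (inv_one_sub_invNorm_pos ((mem_irredDivisors ha).1 hP).2.1.natDegree_pos.ne')

open Classical in
theorem card_filter_dvd_or {P : F[X]} (hP : P.Monic) (a : F[X]) :
    ((monicsOfDegree F P.natDegree).filter (fun h => P ∣ h ∨ P ∣ h + a)).card =
      if P ∣ a then 1 else 2 := by
  have h : (monicsOfDegree F P.natDegree).filter (fun h => P ∣ h ∨ P ∣ h + a) =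
      {P, P + (-a) %ₘ P} := by
    ext r
    simp only [Finset.mem_filter, mem_monicsOfDegree, Finset.mem_insert, Finset.mem_singleton]
    constructor
    · rintro ⟨⟨h1, h2⟩, h3 | h3⟩
      · left
        have := eq_add_modByMonic (b := 0) hP h1 h2 (by simpa using h3)
        simpa using this
      · right
        exact eq_add_modByMonic hP h1 h2 (by simpa using h3)
    · rintro (rfl | rfl)
      · exact ⟨⟨hP, rfl⟩, Or.inl dvd_rfl⟩
      · refine ⟨monic_add_modByMonic hP _, Or.inr ?_⟩
        have := dvd_sub_add_modByMonic P (-a)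
        rw [← dvd_neg] at this
        convert this using 1
        ring
  rw [h]
  split_ifs with hPa
  · rw [(modByMonic_eq_zero_iff_dvd hP).2 (dvd_neg.2 hPa), add_zero]
    simp
  · refine Finset.card_pair fun h => hPa ?_
    rw [left_eq_add] at h
    exact dvd_neg.1 ((modByMonic_eq_zero_iff_dvd hP).1 h)

open Classical in
/-- Upper bound for the number of pairs of irreducible polynomials with a given difference. -/
theorem card_irreducible_pairs_le {a : F[X]} (ha : a ≠ 0) {n : ℕ}
    (hd : a.natDegree < n) :
    (((irredsOfDegree F n).filter (fun h => Irreducible (h + a))).card : ℝ) *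
      (((n + 1) * (n + 3) : ℝ) / 8) ≤ (Nat.card F : ℝ) ^ n * eulerFactor a := by
  have hq := two_le_natCard (F := F)
  set m := n / 2 with hm
  set S := (irredsOfDegree F n).filter (fun h => Irreducible (h + a)) with hS
  -- An element `h0` of `S` certifies that some residue modulo each `P` is good, as the sieve
  -- requires. Over the field of two elements a linear `P` not dividing `a` leaves no good residue,
  -- and then the count may vanish.
  rcases S.eq_empty_or_nonempty with hS0 | ⟨h0, hh0⟩
  · rw [hS0, Finset.card_empty, Nat.cast_zero, zero_mul]
    exact mul_nonneg (by positivity) (eulerFactor_pos ha).le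
  let bad : F[X] → F[X] → Prop := fun P h => P ∣ h ∨ P ∣ h + a
  let w : F[X] → ℕ := fun P => if P ∣ a then 1 else 2
  have hI : ∀ P ∈ irredsUpTo F m, P.Monic ∧ Irreducible P := fun P hP => (mem_irredsUpTo.1 hP).1
  have hbad : ∀ P ∈ irredsUpTo F m, ∀ f g, P ∣ f - g → bad P f → bad P g := by
    rintro P - f g hfg (h | h)
    · exact Or.inl ((dvd_iff_dvd_of_dvd_sub hfg).1 h)
    · refine Or.inr ((dvd_iff_dvd_of_dvd_sub ?_).1 h)
      rwa [add_sub_add_right_eq_sub]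
  have hSgood : ∀ h ∈ S, ∀ P ∈ irredsUpTo F m, ¬ bad P h := by
    intro h hh P hP
    obtain ⟨h1, h2⟩ := Finset.mem_filter.1 hh
    obtain ⟨⟨h3, h4⟩, h5⟩ := mem_irredsOfDegree.1 h1
    obtain ⟨⟨p1, p2⟩, p3⟩ := mem_irredsUpTo.1 hP
    have hlt : P.natDegree < n := by have := p2.natDegree_pos; omega
    have key : ∀ f : F[X], Irreducible f → f.natDegree = n → ¬ P ∣ f := by
      intro f hf hfn hPf
      have := natDegree_eq_of_degree_eq
        (degree_eq_degree_of_associated (p2.associated_of_dvd hf hPf))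
      omega
    rintro (h | h)
    · exact key _ h5 h4 h
    · refine key _ h2 ?_ h
      rw [natDegree_add_eq_left_of_natDegree_lt (by omega), h4]
  have hw1 : ∀ P ∈ irredsUpTo F m, w P < Nat.card F ^ P.natDegree := by
    intro P hP
    rw [← card_monicsOfDegree]
    refine (card_filter_dvd_or (hI P hP).1 a).symm.trans_lt ?_
    refine Finset.card_lt_card (Finset.filter_ssubset.2 ⟨P + h0 %ₘ P, ?_, fun hb => ?_⟩)
    · exact mem_monicsOfDegree.2 (monic_add_modByMonic (hI P hP).1 _)
    · refine hSgood h0 hh0 P hP (hbad P hP _ _ ?_ hb)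
      rw [← neg_sub, dvd_neg]
      exact dvd_sub_add_modByMonic P h0
  have hsieve := card_sifted_mul_le hI (n := n) (m := m) (by omega) bad hbad w
    (fun P hP => card_filter_dvd_or (hI P hP).1 a)
    (fun P _ => by simp only [w]; split_ifs <;> norm_num) hw1
  set g : F[X] → ℝ := fun P => (w P : ℝ) / ((Nat.card F : ℝ) ^ P.natDegree - w P) with hg
  set c : F[X] → ℝ := fun P => if P ∣ a then (1 - invNorm P)⁻¹ else 1 with hc
  have hg0 : ∀ P ∈ irredsUpTo F m, 0 ≤ g P := by
    intro P hP
    have h1 : (w P : ℝ) < (Nat.card F : ℝ) ^ P.natDegree := by exact_mod_cast hw1 P hP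
    exact div_nonneg (Nat.cast_nonneg _) (by linarith)
  have hg1 : ∀ P ∈ irredsUpTo F m, 0 < 1 - w P * invNorm P ∧ 1 + g P = (1 - w P * invNorm P)⁻¹ := by
    intro P hP
    have h1 : (w P : ℝ) < (Nat.card F : ℝ) ^ P.natDegree := by exact_mod_cast hw1 P hP
    have h2 : 0 < (Nat.card F : ℝ) ^ P.natDegree := by positivity
    constructor
    · rw [invNorm, ← div_eq_mul_inv, sub_pos, div_lt_one h2]; exact h1
    · have : (Nat.card F : ℝ) ^ P.natDegree - w P ≠ 0 := by linarith
      rw [hg, invNorm]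
      field_simp
      ring
  have hx : ∀ P ∈ irredsUpTo F m, 0 < invNorm P ∧ invNorm P ≤ 1 / 2 := fun P hP =>
    ⟨invNorm_pos P, invNorm_le_half (hI P hP).2.natDegree_pos.ne'⟩
  have hc1 : ∀ P ∈ irredsUpTo F m, 1 ≤ c P := by
    intro P hP
    simp only [hc]
    split_ifs
    · exact (inv_one_sub_invNorm_pos (hI P hP).2.natDegree_pos.ne').le
    · exact le_rfl
  -- Let `x = invNorm P`, so `1 + g P = (1 - w P * x)⁻¹`. If `P ∤ a`, this is `1 - 2x ≤ (1 - x)²`.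
  -- If `P ∣ a`, only one class is removed and the missing `(1 - x)⁻¹` is `c P`; these losses are
  -- collected in `eulerFactor a`.
  have hloc : ∀ P ∈ irredsUpTo F m, 1 + (((1 - invNorm P)⁻¹) ^ 2 - 1) ≤ c P * (1 + g P) := by
    intro P hP
    obtain ⟨h1, h2⟩ := hg1 P hP
    obtain ⟨hx0, hx1⟩ := hx P hP
    rw [h2, add_sub_cancel]
    by_cases hPa : P ∣ a
    · simp only [hc, w, if_pos hPa, Nat.cast_one, one_mul]
      rw [sq]
    · simp only [hc, w, if_neg hPa, one_mul] at h1 ⊢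
      rw [inv_pow]
      refine inv_anti₀ h1 ?_
      push_cast
      nlinarith [sq_nonneg (invNorm P)]
  have hcmp := Finset.sum_powerset_prod_le_prod_mul_sum (fun P : F[X] => P.natDegree)
    (fun P => ((1 - invNorm P)⁻¹) ^ 2 - 1) g c (irredsUpTo F m) ?_ hg0 hc1 hloc m
  swap
  · intro P hP
    have := inv_one_sub_invNorm_pos (hI P hP).2.natDegree_pos.ne'
    nlinarith
  have hlow := (le_sum_prod_invNorm (F := F) m).trans hcmp
  have hcW : ∏ P ∈ irredsUpTo F m, c P ≤ eulerFactor a := by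
    simp only [hc]
    rw [← Finset.prod_filter]
    refine Finset.prod_le_prod_of_subset_of_one_le (fun P hP => ?_) (fun P hP => ?_)
      (fun P hP _ => ?_)
    · obtain ⟨h1, h2⟩ := Finset.mem_filter.1 hP
      exact (mem_irredDivisors ha).2 ⟨(hI P h1).1, (hI P h1).2, h2⟩
    · exact zero_le_one.trans (inv_one_sub_invNorm_pos
        (hI P (Finset.mem_filter.1 hP).1).2.natDegree_pos.ne').le
    · exact (inv_one_sub_invNorm_pos ((mem_irredDivisors ha).1 hP).2.1.natDegree_pos.ne').le
  simp only [Nat.cast_le] at hlow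
  set L := ∑ A ∈ (irredsUpTo F m).powerset with ∑ P ∈ A, P.natDegree ≤ m, ∏ P ∈ A, g P with hL
  have hL0 : 0 ≤ L := Finset.sum_nonneg fun A hA => Finset.prod_nonneg fun P hP =>
    hg0 P (Finset.mem_powerset.1 (Finset.mem_filter.1 hA).1 hP)
  have hScard : (S.card : ℝ) ≤
      ((monicsOfDegree F n).filter (fun h => ∀ P ∈ irredsUpTo F m, ¬ bad P h)).card := by
    refine Nat.cast_le.2 (Finset.card_le_card fun h hh => ?_)
    refine Finset.mem_filter.2 ⟨?_, hSgood h hh⟩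
    exact mem_monicsOfDegree.2 (mem_irredsOfDegree.1 (Finset.mem_filter.1 hh).1).1
  have hmn : ((n + 1) * (n + 3) : ℝ) / 8 ≤ (m + 1) * (m + 2) / 2 := by
    have h1 : n ≤ 2 * m + 1 := by omega
    have h2 : (n : ℝ) ≤ 2 * m + 1 := by exact_mod_cast h1
    have h3 : (0 : ℝ) ≤ n := Nat.cast_nonneg n
    nlinarith
  have hW := (eulerFactor_pos ha).le
  calc (S.card : ℝ) * (((n + 1) * (n + 3) : ℝ) / 8)
      ≤ S.card * (eulerFactor a * L) := by
        refine mul_le_mul_of_nonneg_left (hmn.trans (hlow.trans ?_)) (Nat.cast_nonneg _)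
        exact mul_le_mul_of_nonneg_right hcW hL0
    _ = (S.card * L) * eulerFactor a := by ring
    _ ≤ _ := by
        refine mul_le_mul_of_nonneg_right ?_ hW
        exact (mul_le_mul_of_nonneg_right hScard hL0).trans hsieve

end

/-! ### Romanoff's lemma: averaging the singular factors. -/

theorem sum_dyadic_add (N : ℕ) :
    ∑ i ∈ Finset.range N, ((2 : ℝ) ^ (i + 1))⁻¹ + ((2 : ℝ) ^ N)⁻¹ = 1 := by
  induction N with
  | zero => simp
  | succ N ih =>
    rw [Finset.sum_range_succ, ← ih, pow_succ]
    field_simp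
    ring

theorem sum_mul_dyadic_add_le (N : ℕ) :
    ∑ i ∈ Finset.range N, (i : ℝ) * ((2 : ℝ) ^ (i + 1))⁻¹ + N * ((2 : ℝ) ^ N)⁻¹ ≤ 1 := by
  have h : ∑ i ∈ Finset.range N, (i : ℝ) * ((2 : ℝ) ^ (i + 1))⁻¹ + N * ((2 : ℝ) ^ N)⁻¹ =
      1 - ((2 : ℝ) ^ N)⁻¹ := by
    induction N with
    | zero => simp
    | succ N ih =>
      rw [Finset.sum_range_succ, ← sub_eq_of_eq_add ih.symm.symm, pow_succ]
      push_cast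
      field_simp
      ring
  rw [h]
  have : 0 < ((2 : ℝ) ^ N)⁻¹ := by positivity
  linarith

/-- Dyadic partial summation: for `2^j ≤ t < 2^(j+1)` the active weights add up to `2^(-j) ≥ 1 / t`,
the last weight `2^(-N)` closing the geometric series. -/
theorem inv_le_sum_dyadic {t : ℕ} (ht : 1 ≤ t) (N : ℕ) (htN : t < 2 ^ (N + 1)) :
    (t : ℝ)⁻¹ ≤ ∑ i ∈ Finset.range N, ((2 : ℝ) ^ (i + 1))⁻¹ * (if t < 2 ^ (i + 1) then 1 else 0) +
      ((2 : ℝ) ^ N)⁻¹ * (if t < 2 ^ (N + 1) then 1 else 0) := by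
  induction N with
  | zero =>
    have : t = 1 := by omega
    subst this
    norm_num
  | succ N ih =>
    rw [if_pos htN, Finset.sum_range_succ]
    by_cases h : t < 2 ^ (N + 1)
    · have := ih h
      rw [if_pos h] at this ⊢
      refine this.trans (le_of_eq ?_)
      rw [pow_succ]
      field_simp
      ring
    · rw [if_neg h, mul_zero, add_zero, mul_one]
      have h1 : ((2 : ℝ) ^ (N + 1)) ≤ t := by exact_mod_cast not_lt.1 h
      have h2 : (t : ℝ)⁻¹ ≤ ((2 : ℝ) ^ (N + 1))⁻¹ := inv_anti₀ (by positivity) h1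
      have h3 : 0 ≤ ∑ i ∈ Finset.range N,
          ((2 : ℝ) ^ (i + 1))⁻¹ * (if t < 2 ^ (i + 1) then (1 : ℝ) else 0) :=
        Finset.sum_nonneg fun i _ => mul_nonneg (by positivity) (by split_ifs <;> norm_num)
      linarith

theorem sum_range_dvd_sub (a t : ℕ) :
    ∑ b ∈ Finset.range a, (if t ∣ a - b then (1 : ℝ) else 0) = (a / t : ℕ) := by
  rw [← Finset.sum_range_reflect, ← Nat.card_multiples, Finset.card_filter]
  push_cast
  refine Finset.sum_congr rfl fun b hb => ?_
  have := Finset.mem_range.1 hb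
  rw [show a - (a - 1 - b) = b + 1 by omega]

/-- For each `a` there are `⌊a / t⌋` admissible `b`. The condition on the right is harmless: a
difference `a - b` lies strictly between `0` and `K`, so neither `t = 0` nor `t ≥ K` divides it. -/
theorem sum_pairs_dvd_sub_le (K t : ℕ) :
    ∑ a ∈ Finset.range K, ∑ b ∈ Finset.range a, (if t ∣ a - b then (1 : ℝ) else 0) ≤
      (K * (K - 1) / 2 : ℝ) * (if 1 ≤ t ∧ t < K then (t : ℝ)⁻¹ else 0) := by
  simp only [sum_range_dvd_sub]
  split_ifs with h
  · have hg : ∑ a ∈ Finset.range K, (a : ℝ) = K * (K - 1) / 2 := by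
      rw [← Nat.cast_sum, eq_div_iff two_ne_zero]
      have := Finset.sum_range_id_mul_two K
      have hK : 1 ≤ K := by omega
      rw [← Nat.cast_two, ← Nat.cast_mul, this]
      push_cast [hK]
      ring
    rw [← hg, Finset.sum_mul]
    refine Finset.sum_le_sum fun a _ => ?_
    rw [← div_eq_mul_inv]
    exact Nat.cast_div_le
  · rw [mul_zero]
    refine (Finset.sum_eq_zero fun a ha => ?_).le
    have ha := Finset.mem_range.1 ha
    rw [Nat.cast_eq_zero]
    rcases Nat.eq_zero_or_pos t with rfl | h1
    · simp
    · exact Nat.div_eq_of_lt (by omega)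

section
variable {F : Type*} [Field F]

theorem pow_sub_one_ne_zero {g : F[X]} (hg : 1 ≤ g.natDegree) {t : ℕ} (ht : 1 ≤ t) :
    g ^ t - 1 ≠ 0 := by
  intro h
  have := congrArg natDegree (sub_eq_zero.1 h)
  rw [natDegree_pow, natDegree_one] at this
  have := Nat.mul_pos ht hg
  omega

theorem prod_dvd_of_forall_dvd {A : Finset F[X]} (hA : ∀ P ∈ A, P.Monic ∧ Irreducible P)
    {f : F[X]} (h : ∀ P ∈ A, P ∣ f) : ∏ P ∈ A, P ∣ f :=
  Finset.prod_dvd_of_coprime (fun _ hP _ hQ hPQ =>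
    isCoprime_of_monic_irreducible (hA _ hP) (hA _ hQ) hPQ) h

/-- The order of `g` modulo the product of the members of `A`. -/
noncomputable def orderMod (g : F[X]) (A : Finset F[X]) : ℕ :=
  orderOf (Ideal.Quotient.mk (Ideal.span {∏ P ∈ A, P}) g)

/-- The default order `0`, taken when no positive power of `g` is `1` modulo the product, is
consistent: it divides only `j = 0`. -/
theorem orderMod_dvd_iff {g : F[X]} {A : Finset F[X]} {j : ℕ} :
    orderMod g A ∣ j ↔ ∏ P ∈ A, P ∣ g ^ j - 1 := by
  rw [orderMod, orderOf_dvd_iff_pow_eq_one, ← map_pow, ← map_one (Ideal.Quotient.mk _),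
    Ideal.Quotient.eq, Ideal.mem_span_singleton]

variable [Finite F]

omit [Finite F] in
theorem prod_inv_one_sub_eq_sum {S : Finset F[X]} :
    ∏ P ∈ S, (1 - invNorm P)⁻¹ = ∑ A ∈ S.powerset, ∏ P ∈ A, ((1 - invNorm P)⁻¹ - 1) := by
  rw [← Finset.prod_one_add]
  exact Finset.prod_congr rfl fun P _ => (add_sub_cancel _ _).symm

/-- Every prime of a set of order `t < 2^(i+1)` divides `g^t - 1` and is prime to `g`. Hence these
primes and those of `g` together divide `g * ∏ (g^t - 1)`, of degree at most `δ * 2^(2i+1)`, and the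
Mertens bound for a given total degree applies. -/
theorem eulerFactor_mul_sum_order_lt_le {g : F[X]} (hg : 1 ≤ g.natDegree) (N i : ℕ) :
    eulerFactor g * ∑ A ∈ (irredsUpTo F N).powerset with
        1 ≤ orderMod g A ∧ orderMod g A < 2 ^ (i + 1), ∏ P ∈ A, ((1 - invNorm P)⁻¹ - 1) ≤
      4 / 3 * (2 * (Nat.log 2 g.natDegree + 2 * i + 1 : ℕ) + 3) := by
  classical
  have hg0 : g ≠ 0 := by rintro rfl; simp at hg
  set T := 2 ^ (i + 1) with hT
  set Q := (irredsUpTo F N).filter (fun P => ∃ t ∈ Finset.Ico 1 T, P ∣ g ^ t - 1) with hQ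
  have hI : ∀ P ∈ irredsUpTo F N, P.Monic ∧ Irreducible P := fun P hP => (mem_irredsUpTo.1 hP).1
  have hQI : ∀ P ∈ Q, P.Monic ∧ Irreducible P := fun P hP => hI P (Finset.mem_filter.1 hP).1
  have hy : ∀ P ∈ irredsUpTo F N, 0 ≤ (1 - invNorm P)⁻¹ - 1 := fun P hP =>
    sub_nonneg.2 (inv_one_sub_invNorm_pos (hI P hP).2.natDegree_pos.ne').le
  have h1 : ∑ A ∈ (irredsUpTo F N).powerset with
        1 ≤ orderMod g A ∧ orderMod g A < T, ∏ P ∈ A, ((1 - invNorm P)⁻¹ - 1) ≤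
      ∏ P ∈ Q, (1 - invNorm P)⁻¹ := by
    rw [prod_inv_one_sub_eq_sum]
    refine Finset.sum_le_sum_of_subset_of_nonneg (fun A hA => ?_) fun A hA _ =>
      Finset.prod_nonneg fun P hP => hy P
        (Finset.mem_filter.1 (Finset.mem_powerset.1 hA hP)).1
    obtain ⟨h1, h2, h3⟩ := Finset.mem_filter.1 hA
    rw [Finset.mem_powerset] at h1 ⊢
    intro P hP
    exact Finset.mem_filter.2 ⟨h1 hP, _, Finset.mem_Ico.2 ⟨h2, h3⟩,
      (Finset.dvd_prod_of_mem (fun P => P) hP).trans (orderMod_dvd_iff.1 dvd_rfl)⟩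
  have hdisj : Disjoint (irredDivisors g) Q := by
    rw [Finset.disjoint_left]
    intro P hP hPQ
    obtain ⟨p1, p2, p3⟩ := (mem_irredDivisors hg0).1 hP
    obtain ⟨-, t, ht, hd⟩ := Finset.mem_filter.1 hPQ
    have ht := (Finset.mem_Ico.1 ht).1
    have : P ∣ 1 := (dvd_sub_right (p3.trans (dvd_pow_self g (by omega)))).1 hd
    exact p2.not_isUnit (isUnit_of_dvd_one this)
  have hU : ∀ P ∈ irredDivisors g ∪ Q, P.Monic ∧ Irreducible P := by
    intro P hP
    rcases Finset.mem_union.1 hP with h | h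
    · exact ⟨((mem_irredDivisors hg0).1 h).1, ((mem_irredDivisors hg0).1 h).2.1⟩
    · exact hQI P h
  set G := g * ∏ t ∈ Finset.Ico 1 T, (g ^ t - 1) with hG
  have hG0 : G ≠ 0 := mul_ne_zero hg0 (Finset.prod_ne_zero_iff.2 fun t ht =>
    pow_sub_one_ne_zero hg (Finset.mem_Ico.1 ht).1)
  have hUdvd : ∏ P ∈ irredDivisors g ∪ Q, P ∣ G := by
    refine prod_dvd_of_forall_dvd hU fun P hP => ?_
    rcases Finset.mem_union.1 hP with h | h
    · exact ((mem_irredDivisors hg0).1 h).2.2.mul_right _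
    · obtain ⟨-, t, ht, hd⟩ := Finset.mem_filter.1 h
      exact (hd.trans (Finset.dvd_prod_of_mem (fun t => g ^ t - 1) ht)).mul_left _
  have hT2 : T = 2 * 2 ^ i := by rw [hT, pow_succ]; ring
  have hTpos : 1 ≤ 2 ^ i := Nat.one_le_two_pow
  have hGdeg : G.natDegree ≤ g.natDegree * 2 ^ (2 * i + 1) := by
    have h2 : (∏ t ∈ Finset.Ico 1 T, (g ^ t - 1)).natDegree ≤
        ∑ t ∈ Finset.range T, t * g.natDegree := by
      refine (natDegree_prod_le _ _).trans ?_
      refine (Finset.sum_le_sum (g := fun t => t * g.natDegree) fun t _ => ?_).trans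
        (Finset.sum_le_sum_of_subset fun t ht => ?_)
      · exact (natDegree_sub_le _ _).trans (by simp [natDegree_pow])
      · exact Finset.mem_range.2 (Finset.mem_Ico.1 ht).2
    have h3 := Finset.sum_range_id_mul_two T
    rw [← Finset.sum_mul] at h2
    refine natDegree_mul_le.trans ((Nat.add_le_add_left h2 _).trans ?_)
    have h4 : ∑ t ∈ Finset.range T, t + 1 ≤ 2 ^ (2 * i + 1) := by
      have h5 : 2 ^ (2 * i + 1) = 2 * (2 ^ i * 2 ^ i) := by rw [pow_succ, two_mul i, pow_add]; ring
      rw [h5]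
      have h6 : (T - 1) + 1 = T := by omega
      nlinarith
    nlinarith
  have hsum : ∑ P ∈ irredDivisors g ∪ Q, P.natDegree <
      2 ^ (Nat.log 2 g.natDegree + 2 * i + 1 + 1) := by
    rw [← natDegree_prod_of_monic _ _ fun P hP => (hU P hP).1]
    refine ((natDegree_le_of_dvd hUdvd hG0).trans hGdeg).trans_lt ?_
    have h2 := Nat.lt_pow_succ_log_self one_lt_two g.natDegree
    rw [show Nat.log 2 g.natDegree + 2 * i + 1 + 1 = (Nat.log 2 g.natDegree).succ + (2 * i + 1) by
      rw [Nat.succ_eq_add_one]; ring, pow_add _ (Nat.log 2 g.natDegree).succ]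
    exact Nat.mul_lt_mul_of_pos_right h2 (by positivity)
  have := prod_inv_one_sub_invNorm_le hU (by omega) hsum
  refine le_trans ?_ this
  rw [Finset.prod_union hdisj]
  exact mul_le_mul_of_nonneg_left h1 (eulerFactor_pos hg0).le

/-- Expanding the Euler product over sets of primes makes `j` enter only through divisibility by an
order, so that the sum over `j = a - b` can be taken first. -/
theorem eulerFactor_pow_sub_one {g : F[X]} (hg : 1 ≤ g.natDegree) {j N : ℕ} (hj : 1 ≤ j)
    (hN : j * g.natDegree ≤ N) :
    eulerFactor (g ^ j - 1) = ∑ A ∈ (irredsUpTo F N).powerset,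
      (∏ P ∈ A, ((1 - invNorm P)⁻¹ - 1)) * (if orderMod g A ∣ j then 1 else 0) := by
  have h0 := pow_sub_one_ne_zero hg hj
  simp only [mul_ite, mul_one, mul_zero]
  rw [eulerFactor, prod_inv_one_sub_eq_sum, ← Finset.sum_filter]
  refine Finset.sum_congr ?_ fun _ _ => rfl
  ext A
  rw [Finset.mem_powerset, Finset.mem_filter, Finset.mem_powerset, orderMod_dvd_iff]
  constructor
  · intro h
    have h' := fun P (hP : P ∈ A) => (mem_irredDivisors h0).1 (h hP)
    refine ⟨fun P hP => mem_irredsUpTo.2 ⟨⟨(h' P hP).1, (h' P hP).2.1⟩, ?_⟩,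
      prod_dvd_of_forall_dvd (fun P hP => ⟨(h' P hP).1, (h' P hP).2.1⟩) fun P hP => (h' P hP).2.2⟩
    refine (natDegree_le_of_dvd (h' P hP).2.2 h0).trans (le_trans ?_ hN)
    exact (natDegree_sub_le _ _).trans (by simp [natDegree_pow])
  · rintro ⟨h1, h2⟩ P hP
    obtain ⟨h3, -⟩ := mem_irredsUpTo.1 (h1 hP)
    exact (mem_irredDivisors h0).2 ⟨h3.1, h3.2,
      (Finset.dvd_prod_of_mem (fun P => P) hP).trans h2⟩

/-- The analogue of Romanoff's lemma: the singular factors of `g ^ a - g ^ b` are bounded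
on average. -/
theorem sum_eulerFactor_le {g : F[X]} (hg : 1 ≤ g.natDegree) (K : ℕ) :
    ∑ a ∈ Finset.range K, ∑ b ∈ Finset.range a,
      eulerFactor g * eulerFactor (g ^ (a - b) - 1) ≤
        (K * (K - 1) / 2 : ℝ) * (12 * g.natDegree) := by
  have hg0 : g ≠ 0 := by rintro rfl; simp at hg
  set I := irredsUpTo F (K * g.natDegree) with hI
  set y : Finset F[X] → ℝ := fun A => ∏ P ∈ A, ((1 - invNorm P)⁻¹ - 1) with hy
  have hy0 : ∀ A ∈ I.powerset, 0 ≤ y A := fun A hA => Finset.prod_nonneg fun P hP => by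
    have := (mem_irredsUpTo.1 (Finset.mem_powerset.1 hA hP)).1.2.natDegree_pos.ne'
    exact sub_nonneg.2 (inv_one_sub_invNorm_pos this).le
  have hKK : (0 : ℝ) ≤ K * (K - 1) / 2 := by
    rcases Nat.eq_zero_or_pos K with rfl | h
    · simp
    · have : (1 : ℝ) ≤ K := by exact_mod_cast h
      have : (0 : ℝ) ≤ K - 1 := by linarith
      positivity
  have hW := (eulerFactor_pos hg0).le
  set B : ℕ → ℝ := fun i => eulerFactor g * ∑ A ∈ I.powerset with
        1 ≤ orderMod g A ∧ orderMod g A < 2 ^ (i + 1), y A with hB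
  have hBle : ∀ i, B i ≤ 4 / 3 * (2 * Nat.log 2 g.natDegree + 5) + 16 / 3 * i := by
    intro i
    refine (eulerFactor_mul_sum_order_lt_le hg _ i).trans (le_of_eq ?_)
    push_cast; ring
  -- The dyadic majorant of `1 / orderMod g A` replaces the weighted sum by the sums `B i` over sets
  -- of small order.
  have hmain : eulerFactor g * ∑ A ∈ I.powerset, y A *
      (if 1 ≤ orderMod g A ∧ orderMod g A < K then (orderMod g A : ℝ)⁻¹ else 0) ≤
      ∑ i ∈ Finset.range K, ((2 : ℝ) ^ (i + 1))⁻¹ * B i + ((2 : ℝ) ^ K)⁻¹ * B K := by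
    simp only [hB, Finset.sum_filter]
    simp only [← mul_assoc, mul_comm _ (eulerFactor g)]
    simp only [mul_assoc]
    rw [← Finset.mul_sum, ← mul_add]
    refine mul_le_mul_of_nonneg_left ?_ hW
    simp only [Finset.mul_sum]
    rw [Finset.sum_comm, ← Finset.sum_add_distrib]
    refine Finset.sum_le_sum fun A hA => ?_
    have hle : (if 1 ≤ orderMod g A ∧ orderMod g A < K then (orderMod g A : ℝ)⁻¹ else 0) ≤
        ∑ i ∈ Finset.range K, ((2 : ℝ) ^ (i + 1))⁻¹ *
            (if 1 ≤ orderMod g A ∧ orderMod g A < 2 ^ (i + 1) then 1 else 0) +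
          ((2 : ℝ) ^ K)⁻¹ * (if 1 ≤ orderMod g A ∧ orderMod g A < 2 ^ (K + 1) then 1 else 0) := by
      split_ifs with h h2
      · have hlt : orderMod g A < 2 ^ (K + 1) :=
          (h.2.trans Nat.lt_two_pow_self).trans (Nat.pow_lt_pow_right one_lt_two (Nat.lt_succ_self K))
        have := inv_le_sum_dyadic h.1 K hlt
        simpa [h.1, hlt] using this
      · exact absurd ⟨h.1, (h.2.trans Nat.lt_two_pow_self).trans
          (Nat.pow_lt_pow_right one_lt_two (Nat.lt_succ_self K))⟩ h2
      all_goals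
        refine add_nonneg (Finset.sum_nonneg fun i _ => mul_nonneg (by positivity) ?_) (by positivity)
        split_ifs <;> norm_num
    refine (mul_le_mul_of_nonneg_left hle (hy0 A hA)).trans (le_of_eq ?_)
    rw [mul_add, Finset.mul_sum]
    congr 1
    · refine Finset.sum_congr rfl fun i _ => ?_
      split_ifs <;> ring
    · split_ifs <;> ring
  have hlog : (Nat.log 2 g.natDegree : ℝ) + 1 ≤ g.natDegree := by
    have h1 := Nat.pow_log_le_self 2 (x := g.natDegree) (by omega)
    have h2 : Nat.log 2 g.natDegree < 2 ^ Nat.log 2 g.natDegree := Nat.lt_two_pow_self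
    exact_mod_cast (by omega : Nat.log 2 g.natDegree + 1 ≤ g.natDegree)
  -- With `l = log₂ δ` rounded down, both dyadic weight sums are at most `1`, giving `4/3 * (2l + 5)
  -- + 16/3 = 8/3 * l + 12`, which is at most `12 δ` since `l + 1 ≤ δ`.
  have hfin : ∑ i ∈ Finset.range K, ((2 : ℝ) ^ (i + 1))⁻¹ * B i + ((2 : ℝ) ^ K)⁻¹ * B K ≤
      12 * g.natDegree := by
    set c : ℝ := 4 / 3 * (2 * Nat.log 2 g.natDegree + 5) with hc
    calc _ ≤ ∑ i ∈ Finset.range K, ((2 : ℝ) ^ (i + 1))⁻¹ * (c + 16 / 3 * i) +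
          ((2 : ℝ) ^ K)⁻¹ * (c + 16 / 3 * K) := by
          refine add_le_add (Finset.sum_le_sum fun i _ => ?_) ?_
          all_goals exact mul_le_mul_of_nonneg_left (hBle _) (by positivity)
      _ = c * (∑ i ∈ Finset.range K, ((2 : ℝ) ^ (i + 1))⁻¹ + ((2 : ℝ) ^ K)⁻¹) + 16 / 3 *
          (∑ i ∈ Finset.range K, (i : ℝ) * ((2 : ℝ) ^ (i + 1))⁻¹ + K * ((2 : ℝ) ^ K)⁻¹) := by
          have : ∑ i ∈ Finset.range K, ((2 : ℝ) ^ (i + 1))⁻¹ * (c + 16 / 3 * i) =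
              c * ∑ i ∈ Finset.range K, ((2 : ℝ) ^ (i + 1))⁻¹ +
              16 / 3 * ∑ i ∈ Finset.range K, (i : ℝ) * ((2 : ℝ) ^ (i + 1))⁻¹ := by
            rw [Finset.mul_sum, Finset.mul_sum, ← Finset.sum_add_distrib]
            exact Finset.sum_congr rfl fun i _ => by ring
          rw [this]
          ring
      _ ≤ c * 1 + 16 / 3 * 1 := by
          rw [sum_dyadic_add]
          have := sum_mul_dyadic_add_le K
          linarith
      _ ≤ _ := by rw [hc]; linarith
  calc _ = eulerFactor g * ∑ A ∈ I.powerset, y A *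
        ∑ a ∈ Finset.range K, ∑ b ∈ Finset.range a,
          (if orderMod g A ∣ a - b then (1 : ℝ) else 0) := by
        simp only [Finset.mul_sum]
        rw [Finset.sum_comm]
        refine Finset.sum_congr rfl fun a ha => ?_
        rw [Finset.sum_comm]
        refine Finset.sum_congr rfl fun b hb => ?_
        have ha := Finset.mem_range.1 ha
        have hb := Finset.mem_range.1 hb
        rw [eulerFactor_pow_sub_one hg (N := K * g.natDegree) (by omega)
          (Nat.mul_le_mul_right _ (by omega)), Finset.mul_sum]
    _ ≤ eulerFactor g * ∑ A ∈ I.powerset, y A * ((K * (K - 1) / 2 : ℝ) *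
          (if 1 ≤ orderMod g A ∧ orderMod g A < K then (orderMod g A : ℝ)⁻¹ else 0)) := by
        refine mul_le_mul_of_nonneg_left (Finset.sum_le_sum fun A hA => ?_) hW
        exact mul_le_mul_of_nonneg_left (sum_pairs_dvd_sub_le K _) (hy0 A hA)
    _ = (K * (K - 1) / 2 : ℝ) * (eulerFactor g * ∑ A ∈ I.powerset, y A *
          (if 1 ≤ orderMod g A ∧ orderMod g A < K then (orderMod g A : ℝ)⁻¹ else 0)) := by
        simp only [Finset.mul_sum]
        exact Finset.sum_congr rfl fun A _ => by ring
    _ ≤ _ := mul_le_mul_of_nonneg_left (hmain.trans hfin) hKK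

end

/-! ### The second moment and the lower bound. -/

theorem Finset.sum_range_sum_range {M : Type*} [AddCommMonoid M] (e : ℕ → ℕ → M) (K : ℕ) :
    ∑ a ∈ Finset.range K, ∑ b ∈ Finset.range K, e a b =
      ∑ a ∈ Finset.range K, e a a +
        ∑ a ∈ Finset.range K, ∑ b ∈ Finset.range a, (e a b + e b a) := by
  induction K with
  | zero => simp
  | succ K ih =>
    rw [Finset.sum_range_succ, Finset.sum_congr rfl fun a _ => Finset.sum_range_succ (e a) K,
      Finset.sum_add_distrib, ih, Finset.sum_range_succ (e K), Finset.sum_range_succ (fun a => e a a),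
      Finset.sum_range_succ _ K, Finset.sum_add_distrib]
    abel

/-- Cauchy–Schwarz applied to the fibre sizes of `φ`. -/
theorem Finset.card_sq_le_card_image_mul {α β : Type*} [DecidableEq β] (S : Finset α) (φ : α → β) :
    S.card ^ 2 ≤ (S.image φ).card * ∑ p ∈ S, (S.filter (fun r => φ r = φ p)).card := by
  have h1 : S.card = ∑ b ∈ S.image φ, (S.filter (fun r => φ r = b)).card :=
    Finset.card_eq_sum_card_image φ S
  have h2 : ∑ p ∈ S, (S.filter (fun r => φ r = φ p)).card =
      ∑ b ∈ S.image φ, (S.filter (fun r => φ r = b)).card ^ 2 := by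
    rw [← Finset.sum_fiberwise_of_maps_to (s := S) (t := S.image φ) (g := φ)
      fun p hp => Finset.mem_image_of_mem φ hp]
    refine Finset.sum_congr rfl fun b _ => ?_
    rw [Finset.sum_congr rfl (g := fun _ => (S.filter (fun r => φ r = b)).card),
      Finset.sum_const, smul_eq_mul, sq]
    intro p hp
    rw [(Finset.mem_filter.1 hp).2]
  rw [h2]
  conv_lhs => rw [h1]
  exact sq_sum_le_card_mul_sum_sq

section
variable {F : Type*} [Field F] [Finite F]

/-- Since `g^a - g^b = g^b * (g^(a-b) - 1)`, each prime divisor belongs to `g` or to `g^(a-b) - 1`;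
the unit `u` adds none. -/
theorem eulerFactor_C_mul_sub_le {g : F[X]} (hg : 1 ≤ g.natDegree) {u : F} (hu : u ≠ 0) {a b : ℕ}
    (hab : b < a) :
    C u * (g ^ a - g ^ b) ≠ 0 ∧
    eulerFactor (C u * (g ^ a - g ^ b)) ≤ eulerFactor g * eulerFactor (g ^ (a - b) - 1) := by
  classical
  have hg0 : g ≠ 0 := by rintro rfl; simp at hg
  have h1 := pow_sub_one_ne_zero hg (t := a - b) (by omega)
  have e : C u * (g ^ a - g ^ b) = C u * (g ^ b * (g ^ (a - b) - 1)) := by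
    rw [mul_sub (g ^ b), ← pow_add, Nat.add_sub_cancel' hab.le, mul_one]
  have hne : C u * (g ^ a - g ^ b) ≠ 0 := by
    rw [e]
    exact mul_ne_zero (C_ne_zero.2 hu) (mul_ne_zero (pow_ne_zero _ hg0) h1)
  refine ⟨hne, ?_⟩
  have hone : ∀ f : F[X], f ≠ 0 → ∀ P ∈ irredDivisors f, 1 ≤ (1 - invNorm P)⁻¹ := fun f hf P hP =>
    (inv_one_sub_invNorm_pos ((mem_irredDivisors hf).1 hP).2.1.natDegree_pos.ne').le
  have hsub : irredDivisors (C u * (g ^ a - g ^ b)) ⊆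
      irredDivisors g ∪ irredDivisors (g ^ (a - b) - 1) := by
    intro P hP
    obtain ⟨p1, p2, p3⟩ := (mem_irredDivisors hne).1 hP
    rw [Finset.mem_union, mem_irredDivisors hg0, mem_irredDivisors h1]
    rw [e] at p3
    rcases p2.prime.dvd_or_dvd p3 with h | h
    · exact absurd (isUnit_of_dvd_unit h (isUnit_C.2 hu.isUnit)) p2.not_isUnit
    · rcases p2.prime.dvd_or_dvd h with h | h
      · exact Or.inl ⟨p1, p2, p2.prime.dvd_of_dvd_pow h⟩
      · exact Or.inr ⟨p1, p2, h⟩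
  have hU : ∀ P ∈ irredDivisors g ∪ irredDivisors (g ^ (a - b) - 1), 1 ≤ (1 - invNorm P)⁻¹ := by
    intro P hP
    rcases Finset.mem_union.1 hP with h | h
    exacts [hone _ hg0 P h, hone _ h1 P h]
  calc eulerFactor (C u * (g ^ a - g ^ b))
      ≤ ∏ P ∈ irredDivisors g ∪ irredDivisors (g ^ (a - b) - 1), (1 - invNorm P)⁻¹ :=
        Finset.prod_le_prod_of_subset_of_one_le hsub
          (fun P hP => zero_le_one.trans (hone _ hne P hP)) fun P hP _ => hU P hP
    _ ≤ (∏ P ∈ irredDivisors g ∪ irredDivisors (g ^ (a - b) - 1), (1 - invNorm P)⁻¹) *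
        ∏ P ∈ irredDivisors g ∩ irredDivisors (g ^ (a - b) - 1), (1 - invNorm P)⁻¹ :=
        le_mul_of_one_le_right (Finset.prod_nonneg fun P hP => zero_le_one.trans (hU P hP))
          (Finset.one_le_prod fun P hP => hone _ hg0 P (Finset.mem_inter.1 hP).1)
    _ = _ := Finset.prod_union_inter

open Classical in
/-- The polynomials `h + u * g ^ k` with `h` monic irreducible of degree `n` and `k < K`. -/
noncomputable def romanoffFinset (n : ℕ) (g : F[X]) (u : F) (K : ℕ) : Finset F[X] :=
  (irredsOfDegree F n ×ˢ Finset.range K).image (fun p => p.1 + C u * g ^ p.2)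

open Classical in
theorem card_irreducible_shift_le {g : F[X]} (hg : 1 ≤ g.natDegree) {u : F} (hu : u ≠ 0)
    {n a b : ℕ} (hab : b < a) (ha : a * g.natDegree < n) {s : F[X]}
    (hs : s = C u * (g ^ a - g ^ b) ∨ s = -(C u * (g ^ a - g ^ b))) :
    (((irredsOfDegree F n).filter (fun h => Irreducible (h + s))).card : ℝ) ≤
      8 * (Nat.card F : ℝ) ^ n / ((n + 1) * (n + 3)) *
        (eulerFactor g * eulerFactor (g ^ (a - b) - 1)) := by
  obtain ⟨h0, h1⟩ := eulerFactor_C_mul_sub_le hg hu hab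
  have hd : (C u * (g ^ a - g ^ b)).natDegree < n := by
    refine lt_of_le_of_lt (natDegree_C_mul_le _ _) (lt_of_le_of_lt (natDegree_sub_le _ _) ?_)
    rw [natDegree_pow, natDegree_pow, max_lt_iff]
    exact ⟨ha, lt_of_le_of_lt (Nat.mul_le_mul_right _ hab.le) ha⟩
  have hs' : s ≠ 0 ∧ s.natDegree < n ∧ eulerFactor s = eulerFactor (C u * (g ^ a - g ^ b)) := by
    rcases hs with rfl | rfl
    · exact ⟨h0, hd, rfl⟩
    · refine ⟨neg_ne_zero.2 h0, by rwa [natDegree_neg], ?_⟩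
      unfold eulerFactor
      congr 1
      ext P
      rw [mem_irredDivisors (neg_ne_zero.2 h0), mem_irredDivisors h0, dvd_neg]
  have h2 := card_irreducible_pairs_le hs'.1 hs'.2.1
  rw [hs'.2.2] at h2
  have h3 : (0 : ℝ) < (n + 1) * (n + 3) := by positivity
  rw [← le_div_iff₀ (by positivity)] at h2
  refine h2.trans ?_
  rw [show (Nat.card F : ℝ) ^ n * eulerFactor (C u * (g ^ a - g ^ b)) / ((n + 1) * (n + 3) / 8) =
    8 * (Nat.card F : ℝ) ^ n / ((n + 1) * (n + 3)) * eulerFactor (C u * (g ^ a - g ^ b)) by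
      field_simp]
  exact mul_le_mul_of_nonneg_left h1 (by positivity)

/-- The term `K * π(n)` bounds the coincidences with equal exponents. The constant is `96 = 2 * 8 *
12 / 2`: two orders of the exponents, the sieve constant, and the average `12 δ` over `K * (K - 1) /
2` pairs. -/
theorem sq_le_card_romanoffFinset_mul {g : F[X]} (hg : 1 ≤ g.natDegree) {u : F} (hu : u ≠ 0)
    {n K : ℕ} (hK : (K - 1) * g.natDegree < n) :
    (((irredsOfDegree F n).card : ℝ) * K) ^ 2 ≤ (romanoffFinset n g u K).card *
      (K * (irredsOfDegree F n).card + 96 * (Nat.card F : ℝ) ^ n / ((n + 1) * (n + 3)) *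
        (K * (K - 1) * g.natDegree)) := by
  classical
  set S := irredsOfDegree F n ×ˢ Finset.range K with hS
  have hcs := Finset.card_sq_le_card_image_mul S (fun p => p.1 + C u * g ^ p.2)
  have hcs' : (((irredsOfDegree F n).card : ℝ) * K) ^ 2 ≤ (romanoffFinset n g u K).card *
      ((∑ p ∈ S, (S.filter (fun r => r.1 + C u * g ^ r.2 = p.1 + C u * g ^ p.2)).card : ℕ) : ℝ) := by
    rw [hS, Finset.card_product, Finset.card_range] at hcs
    exact_mod_cast hcs
  refine hcs'.trans (mul_le_mul_of_nonneg_left ?_ (Nat.cast_nonneg _))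
  set e : ℕ → ℕ → ℝ := fun a b => (((irredsOfDegree F n).filter
    (fun h => Irreducible (h + C u * (g ^ a - g ^ b)))).card : ℝ) with he
  have h1 : ((∑ p ∈ S, (S.filter (fun r => r.1 + C u * g ^ r.2 = p.1 + C u * g ^ p.2)).card : ℕ) : ℝ)
      ≤ ∑ a ∈ Finset.range K, ∑ b ∈ Finset.range K, e a b := by
    -- A coincidence with `p` is determined by its exponent `b`, its first component then being `p.1
    -- + u * (g^p.2 - g^b)`, which must be irreducible.
    have h2 : ∀ p ∈ S, (S.filter (fun r => r.1 + C u * g ^ r.2 = p.1 + C u * g ^ p.2)).card ≤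
        ∑ b ∈ Finset.range K, if Irreducible (p.1 + C u * (g ^ p.2 - g ^ b)) then 1 else 0 := by
      intro p _
      rw [← Finset.card_filter]
      refine Finset.card_le_card_of_injOn Prod.snd ?_ ?_
      · intro r hr
        obtain ⟨h1, h2⟩ := Finset.mem_filter.1 hr
        obtain ⟨h3, h4⟩ := Finset.mem_product.1 h1
        refine Finset.mem_filter.2 ⟨h4, ?_⟩
        rw [show p.1 + C u * (g ^ p.2 - g ^ r.2) = r.1 by linear_combination -h2]
        exact (mem_irredsOfDegree.1 h3).2
      · intro r hr t ht hrt
        have h2 := (Finset.mem_filter.1 hr).2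
        have h3 := (Finset.mem_filter.1 ht).2
        have hrt : r.2 = t.2 := hrt
        rw [hrt] at h2
        exact Prod.ext (add_right_cancel (h2.trans h3.symm)) hrt
    refine le_trans (Nat.cast_le.2 (Finset.sum_le_sum h2)) (le_of_eq ?_)
    rw [hS, Finset.sum_product_right]
    push_cast
    refine Finset.sum_congr rfl fun a _ => ?_
    rw [Finset.sum_comm]
    refine Finset.sum_congr rfl fun b _ => ?_
    simp only [he, Finset.card_filter]
    push_cast
    rfl
  refine h1.trans ?_
  rw [Finset.sum_range_sum_range]
  refine add_le_add ?_ ?_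
  · rw [← nsmul_eq_mul]
    refine (Finset.sum_le_card_nsmul _ _ ((irredsOfDegree F n).card : ℝ) fun a _ => ?_).trans
      (by rw [Finset.card_range])
    exact Nat.cast_le.2 (Finset.card_filter_le _ _)
  · have h3 : ∀ a ∈ Finset.range K, ∀ b ∈ Finset.range a, e a b + e b a ≤
        16 * (Nat.card F : ℝ) ^ n / ((n + 1) * (n + 3)) *
        (eulerFactor g * eulerFactor (g ^ (a - b) - 1)) := by
      intro a ha b hb
      have ha := Finset.mem_range.1 ha
      have hb := Finset.mem_range.1 hb
      have hlt : a * g.natDegree < n :=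
        lt_of_le_of_lt (Nat.mul_le_mul_right _ (by omega)) hK
      have k1 := card_irreducible_shift_le hg hu hb hlt (Or.inl rfl)
      have k2 := card_irreducible_shift_le hg hu hb hlt (s := C u * (g ^ b - g ^ a))
        (Or.inr (by ring))
      refine (add_le_add k1 k2).trans (le_of_eq ?_)
      ring
    refine (Finset.sum_le_sum fun a ha => Finset.sum_le_sum fun b hb => h3 a ha b hb).trans ?_
    simp only [← Finset.mul_sum]
    have := mul_le_mul_of_nonneg_left (sum_eulerFactor_le (F := F) hg K)
      (show (0 : ℝ) ≤ 16 * (Nat.card F : ℝ) ^ n / ((n + 1) * (n + 3)) by positivity)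
    simp only [← Finset.mul_sum] at this
    refine this.trans (le_of_eq ?_)
    ring

theorem card_irredsOfDegree_le_card_romanoffFinset (n : ℕ) (g : F[X]) (u : F) {K : ℕ} (hK : 1 ≤ K) :
    (irredsOfDegree F n).card ≤ (romanoffFinset n g u K).card := by
  classical
  refine Finset.card_le_card_of_injOn (fun h => h + C u * g ^ 0) (fun h hh => ?_)
    fun _ _ _ _ h => add_right_cancel h
  exact Finset.mem_image.2 ⟨(h, 0), Finset.mem_product.2 ⟨hh, Finset.mem_range.2 hK⟩, rfl⟩

theorem lt_card_romanoffFinset {g : F[X]} (hg : 1 ≤ g.natDegree) {u : F} (hu : u ≠ 0)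
    {n K : ℕ} (hK1 : 1 ≤ K) (hK : (K - 1) * g.natDegree < n) (hK' : n ≤ K * g.natDegree) :
    0.01 * (Nat.card F : ℝ) ^ n < g.natDegree * (romanoffFinset n g u K).card := by
  have hn : n ≠ 0 := by omega
  have hq := two_le_natCard (F := F)
  have hδ1 : (1 : ℝ) ≤ g.natDegree := by exact_mod_cast hg
  have hp1 : (Nat.card F : ℝ) ^ n ≤ 2 * (n * (irredsOfDegree F n).card) := by
    exact_mod_cast card_pow_le_two_mul (F := F) hn
  have hp2 : (n : ℝ) * (irredsOfDegree F n).card ≤ (Nat.card F : ℝ) ^ n := by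
    exact_mod_cast mul_card_irredsOfDegree_le (F := F) hn
  have hp4 : (Nat.card F : ℝ) ^ n + 2 ≤
      n * (irredsOfDegree F n).card + 2 * (Nat.card F : ℝ) ^ (n / 2) := by
    exact_mod_cast card_pow_add_two_le (F := F) hn
  have hKd' : (n : ℝ) ≤ K * g.natDegree := by exact_mod_cast hK'
  have hcs := sq_le_card_romanoffFinset_mul hg hu hK
  have hsplit : (n : ℝ) < 50 * g.natDegree ∨ 50 * g.natDegree ≤ n := by
    rcases lt_or_ge n (50 * g.natDegree) with h | h
    · left; exact_mod_cast h
    · right; exact h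
  set Y : ℝ := (Nat.card F : ℝ) ^ n with hY
  have hY0 : 0 < Y := by positivity
  set δ : ℝ := (g.natDegree : ℝ) with hδ
  set p : ℝ := ((irredsOfDegree F n).card : ℝ) with hp
  set T : ℝ := ((romanoffFinset n g u K).card : ℝ) with hT
  have hpT : p ≤ T := Nat.cast_le.2 (card_irredsOfDegree_le_card_romanoffFinset n g u hK1)
  have hn0 : (0 : ℝ) < n := by exact_mod_cast Nat.pos_of_ne_zero hn
  have hp0 : 0 < p := by
    by_contra! h
    nlinarith
  -- For `n < 50 δ` the values with `k = 0` are enough: `δ * π(n) > n * π(n) / 50 ≥ q^n / 100`.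
  rcases hsplit with hs | hbig
  · nlinarith [mul_lt_mul_of_pos_right hs hp0, mul_le_mul_of_nonneg_left hpT (by linarith : 0 ≤ δ)]
  -- Here `n ≥ 50`, so `2 * q^(n/2)` is negligible against `q^n`.
  · have hp3 : 0.99 * Y ≤ n * p := by
      have h2 : (Nat.card F : ℝ) ^ (n / 2) * 2 ^ 25 ≤ Y := by
        calc (Nat.card F : ℝ) ^ (n / 2) * 2 ^ 25 ≤ (Nat.card F : ℝ) ^ (n / 2) * (Nat.card F : ℝ) ^ 25 := by
              gcongr
          _ = (Nat.card F : ℝ) ^ (n / 2 + 25) := (pow_add _ _ _).symm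
          _ ≤ Y := pow_le_pow_right₀ (by linarith) (by omega)
      norm_num at h2 ⊢
      linarith
    have hKr : (1 : ℝ) ≤ K := by exact_mod_cast hK1
    have hKd : ((K : ℝ) - 1) * δ ≤ n := by
      have : (((K - 1) * g.natDegree : ℕ) : ℝ) ≤ n := Nat.cast_le.2 hK.le
      push_cast [hK1] at this
      exact this
    have hT0 : 0 < T := hp0.trans_le hpT
    have hbound : 96 * Y / ((n + 1) * (n + 3)) * (K * (K - 1) * δ) ≤ K * (96 * Y / n) := by
      have e : 96 * Y / ((n + 1) * (n + 3)) * (K * (K - 1) * δ) =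
        K * (96 * Y * ((K - 1) * δ) / ((n + 1) * (n + 3))) := by ring
      rw [e]
      refine mul_le_mul_of_nonneg_left ?_ (by linarith)
      rw [div_le_div_iff₀ (by positivity) hn0]
      have : (K - 1) * δ * n ≤ (n + 1) * (n + 3) := by nlinarith
      nlinarith
    have h4 : (p * K) ^ 2 ≤ T * (K * (p + 96 * Y / n)) := by
      refine hcs.trans (mul_le_mul_of_nonneg_left ?_ hT0.le)
      linarith
    have h5 : K * p ^ 2 ≤ T * (p + 96 * Y / n) := by
      have hK0 : (0 : ℝ) < K := by linarith
      refine le_of_mul_le_mul_left ?_ hK0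
      linarith
    have h6 : K * (n * p) ^ 2 ≤ T * n * (97 * Y) := by
      have e : T * n * (n * p + 96 * Y) = n ^ 2 * (T * (p + 96 * Y / n)) := by
        field_simp
      calc K * (n * p) ^ 2 = n ^ 2 * (K * p ^ 2) := by ring
        _ ≤ n ^ 2 * (T * (p + 96 * Y / n)) := mul_le_mul_of_nonneg_left h5 (by positivity)
        _ = T * n * (n * p + 96 * Y) := e.symm
        _ ≤ T * n * (97 * Y) := mul_le_mul_of_nonneg_left (by linarith) (by positivity)
    have h7 : 0.98 * Y ^ 2 ≤ (n * p) ^ 2 := by nlinarith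
    have h8 : K * (0.98 * Y) ≤ T * n * 97 := by
      refine le_of_mul_le_mul_right ?_ hY0
      have := mul_le_mul_of_nonneg_left h7 (by linarith : (0 : ℝ) ≤ K)
      nlinarith
    -- The hypothesis `n ≤ K * δ` eliminates `K`. The final constant is `0.98 / 97 > 0.01`.
    have h9 : 0.98 * Y ≤ 97 * (δ * T) := by
      refine le_of_mul_le_mul_left ?_ hn0
      have h10 := mul_le_mul_of_nonneg_right hKd' (by positivity : 0 ≤ 0.98 * Y)
      have h11 := mul_le_mul_of_nonneg_left h8 (by linarith : 0 ≤ δ)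
      linarith
    norm_num at h9 ⊢
    linarith

end

/-! ### From finite sets of values to the two densities. -/

section
variable {F : Type*} [Field F] [Finite F]

theorem mem_romanoffFinset {n : ℕ} {g : F[X]} {u : F} {K : ℕ} {f : F[X]} :
    f ∈ romanoffFinset n g u K ↔
      ∃ h k, h ∈ irredsOfDegree F n ∧ k < K ∧ h + C u * g ^ k = f := by
  simp only [romanoffFinset, Finset.mem_image, Finset.mem_product, Finset.mem_range, Prod.exists,
    and_assoc]

theorem monic_of_mem_romanoffFinset {g : F[X]} {u : F} {n K : ℕ}
    (hK : (K - 1) * g.natDegree < n) {f : F[X]} (hf : f ∈ romanoffFinset n g u K) :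
    f.Monic ∧ f.natDegree = n := by
  obtain ⟨h, k, hh, hk, rfl⟩ := mem_romanoffFinset.1 hf
  obtain ⟨⟨h1, h2⟩, -⟩ := mem_irredsOfDegree.1 hh
  have hd : (C u * g ^ k).natDegree < h.natDegree := by
    refine lt_of_le_of_lt (natDegree_C_mul_le _ _) ?_
    rw [natDegree_pow, h2]
    exact lt_of_le_of_lt (Nat.mul_le_mul_right _ (by omega)) hK
  exact ⟨h1.add_of_left (degree_lt_degree hd), by rw [natDegree_add_eq_left_of_natDegree_lt hd, h2]⟩

omit [Finite F] in
-- `g^k = f - h` has degree at most `n`. The borderline `k * δ = n` is allowed here, whereas the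
-- lower bound uses only `k * δ < n`.
theorem lt_div_add_one_of_eq_add {g h f : F[X]} (hg : 1 ≤ g.natDegree) {n k : ℕ}
    (hf : f.natDegree = n) (hh : h.natDegree = n) (e : f = h + g ^ k) :
    k < n / g.natDegree + 1 := by
  have h1 : (g ^ k).natDegree ≤ n := by
    rw [show g ^ k = f - h by rw [e]; ring]
    refine (natDegree_sub_le _ _).trans ?_
    rw [hf, hh, max_self]
  rw [natDegree_pow] at h1
  exact Nat.lt_succ_of_le ((Nat.le_div_iff_mul_le hg).2 h1)

theorem card_irredsOfDegree_mul_le {n δ : ℕ} (hδ : 1 ≤ δ) (hn : δ ≤ n) :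
    ((irredsOfDegree F n).card : ℝ) * ((n / δ + 1 : ℕ) : ℝ) ≤ 2 / δ * (Nat.card F : ℝ) ^ n := by
  have hδ' : (0 : ℝ) < δ := by exact_mod_cast hδ
  have hn' : (δ : ℝ) ≤ n := by exact_mod_cast hn
  have h1 : ((n / δ + 1 : ℕ) : ℝ) ≤ 2 / δ * n := by
    push_cast
    refine (add_le_add_left Nat.cast_div_le 1).trans ?_
    rw [div_add_one hδ'.ne', div_mul_eq_mul_div]
    gcongr
    linarith
  have h2 : (n : ℝ) * (irredsOfDegree F n).card ≤ (Nat.card F : ℝ) ^ n := by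
    exact_mod_cast mul_card_irredsOfDegree_le (F := F) (n := n) (by omega)
  calc ((irredsOfDegree F n).card : ℝ) * ((n / δ + 1 : ℕ) : ℝ)
      ≤ (irredsOfDegree F n).card * (2 / δ * n) :=
        mul_le_mul_of_nonneg_left h1 (Nat.cast_nonneg _)
    _ = 2 / δ * (n * (irredsOfDegree F n).card) := by ring
    _ ≤ _ := mul_le_mul_of_nonneg_left h2 (by positivity)

/-- `K = ⌈n / δ⌉` counts the exponents `k` with `k * δ < n`, for which adding a multiple of `g^k`
leaves the leading term of `h` unchanged. -/
theorem exists_ceil_div {n δ : ℕ} (hδ : 1 ≤ δ) (hn : δ ≤ n) :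
    ∃ K, 1 ≤ K ∧ (K - 1) * δ < n ∧ n ≤ K * δ := by
  refine ⟨(n - 1) / δ + 1, Nat.le_add_left 1 _, ?_, ?_⟩
  · have := Nat.div_mul_le_self (n - 1) δ
    rw [Nat.add_sub_cancel]
    omega
  · have := Nat.lt_div_mul_add (a := n - 1) hδ
    rw [add_mul, one_mul]
    omega

theorem monicRomanoffSet_subset {g : F[X]} (hg : 1 ≤ g.natDegree) (n : ℕ) :
    monicRomanoffSet n g ⊆ romanoffFinset n g (1 : F) (n / g.natDegree + 1) := by
  rintro f ⟨-, hf2, h, k, h1, h2, h3, e⟩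
  have hh := natDegree_eq_of_degree_eq_some h3
  refine mem_romanoffFinset.2 ⟨h, k, mem_irredsOfDegree.2 ⟨⟨h1, hh⟩, h2⟩,
    lt_div_add_one_of_eq_add hg (natDegree_eq_of_degree_eq_some hf2) hh e, ?_⟩
  rw [e, C_1, one_mul]

theorem card_romanoffFinset_le (n : ℕ) (g : F[X]) (u : F) (K : ℕ) :
    (romanoffFinset n g u K).card ≤ (irredsOfDegree F n).card * K := by
  classical
  refine Finset.card_image_le.trans ?_
  rw [Finset.card_product, Finset.card_range]

theorem subset_monicRomanoffSet {g : F[X]} {n K : ℕ} (hK : (K - 1) * g.natDegree < n) :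
    (romanoffFinset n g (1 : F) K : Set F[X]) ⊆ monicRomanoffSet n g := by
  intro f hf
  obtain ⟨hf1, hf2⟩ := monic_of_mem_romanoffFinset hK hf
  obtain ⟨h, k, hh, hk, e⟩ := mem_romanoffFinset.1 hf
  obtain ⟨⟨h1, h2⟩, h3⟩ := mem_irredsOfDegree.1 hh
  refine ⟨hf1, ?_, h, k, h1, h3, ?_, ?_⟩
  · rw [degree_eq_natDegree hf1.ne_zero, hf2]
  · rw [degree_eq_natDegree h1.ne_zero, h2]
  · rw [← e, C_1, one_mul]

open Classical in
/-- The polynomials `c * (h + c⁻¹ * g ^ k) = c * h + g ^ k` with `c` a unit, `h` monic irreducible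
of degree `n` and `k < K`. -/
noncomputable def scaledRomanoffFinset [Fintype Fˣ] (n : ℕ) (g : F[X]) (K : ℕ) : Finset F[X] :=
  (Finset.univ : Finset Fˣ).biUnion fun c =>
    (romanoffFinset n g (c⁻¹ : Fˣ) K).image (fun f => C (c : F) * f)

theorem mem_scaledRomanoffFinset [Fintype Fˣ] {n : ℕ} {g : F[X]} {K : ℕ} {f : F[X]} :
    f ∈ scaledRomanoffFinset n g K ↔
      ∃ (c : Fˣ) (h : F[X]) (k : ℕ), h ∈ irredsOfDegree F n ∧ k < K ∧ C (c : F) * h + g ^ k = f := by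
  have key : ∀ (c : Fˣ) (h : F[X]) (k : ℕ),
      C (c : F) * (h + C ((c⁻¹ : Fˣ) : F) * g ^ k) = C (c : F) * h + g ^ k := by
    intro c h k
    rw [mul_add, ← mul_assoc, ← C_mul, Units.mul_inv, C_1, one_mul]
  simp only [scaledRomanoffFinset, Finset.mem_biUnion, Finset.mem_univ, true_and,
    Finset.mem_image, mem_romanoffFinset]
  constructor
  · rintro ⟨c, _, ⟨h, k, hh, hk, rfl⟩, rfl⟩
    exact ⟨c, h, k, hh, hk, (key c h k).symm⟩
  · rintro ⟨c, h, k, hh, hk, rfl⟩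
    exact ⟨c, _, ⟨h, k, hh, hk, rfl⟩, key c h k⟩

theorem romanoffSet_subset [Fintype Fˣ] {g : F[X]} (hg : 1 ≤ g.natDegree) (n : ℕ) :
    romanoffSet n g ⊆ scaledRomanoffFinset n g (n / g.natDegree + 1) := by
  rintro f ⟨hf, h, k, h2, h3, e⟩
  have hh := natDegree_eq_of_degree_eq_some h3
  have hl : h.leadingCoeff ≠ 0 := leadingCoeff_ne_zero.2 h2.ne_zero
  refine mem_scaledRomanoffFinset.2 ⟨Units.mk0 _ hl, C h.leadingCoeff⁻¹ * h, k,
    mem_irredsOfDegree.2 ⟨⟨?_, ?_⟩, ?_⟩,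
    lt_div_add_one_of_eq_add hg (natDegree_eq_of_degree_eq_some hf) hh e, ?_⟩
  · rw [mul_comm]; exact monic_mul_leadingCoeff_inv h2.ne_zero
  · rw [natDegree_C_mul (inv_ne_zero hl), hh]
  · exact (irreducible_isUnit_mul (isUnit_C.2 (inv_ne_zero hl).isUnit)).2 h2
  · rw [Units.val_mk0, ← mul_assoc, ← C_mul, mul_inv_cancel₀ hl, C_1, one_mul, e]

theorem subset_romanoffSet [Fintype Fˣ] {g : F[X]} {n K : ℕ} (hK : (K - 1) * g.natDegree < n) :
    (scaledRomanoffFinset n g K : Set F[X]) ⊆ romanoffSet n g := by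
  intro f hf
  obtain ⟨c, h, k, hh, hk, rfl⟩ := mem_scaledRomanoffFinset.1 hf
  obtain ⟨⟨h1, h2⟩, h3⟩ := mem_irredsOfDegree.1 hh
  have hd : (C (c : F) * h).degree = n := by
    rw [degree_C_mul c.ne_zero, degree_eq_natDegree h1.ne_zero, h2]
  refine ⟨?_, C (c : F) * h, k, ?_, hd, rfl⟩
  · rw [degree_add_eq_left_of_degree_lt, hd]
    rw [hd]
    refine degree_le_natDegree.trans_lt ?_
    rw [natDegree_pow]
    exact_mod_cast lt_of_le_of_lt (Nat.mul_le_mul_right _ (by omega)) hK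
  · exact (irreducible_isUnit_mul (isUnit_C.2 c.isUnit)).2 h3

/-- The pieces for different `c` are disjoint, because `c` is the leading coefficient of every
member of its piece. -/
theorem card_scaledRomanoffFinset [Fintype Fˣ] {g : F[X]} {n K : ℕ}
    (hK : (K - 1) * g.natDegree < n) :
    (scaledRomanoffFinset n g K).card =
      ∑ c : Fˣ, (romanoffFinset n g ((c⁻¹ : Fˣ) : F) K).card := by
  classical
  rw [scaledRomanoffFinset, Finset.card_biUnion]
  · refine Finset.sum_congr rfl fun c _ => Finset.card_image_of_injective _ ?_
    exact mul_right_injective₀ (C_ne_zero.2 c.ne_zero)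
  · intro c _ d _ hcd
    rw [Function.onFun, Finset.disjoint_left]
    intro f hf1 hf2
    obtain ⟨f1, h1, rfl⟩ := Finset.mem_image.1 hf1
    obtain ⟨f2, h2, e⟩ := Finset.mem_image.1 hf2
    have := congrArg leadingCoeff e
    rw [leadingCoeff_mul, leadingCoeff_mul, leadingCoeff_C, leadingCoeff_C,
      (monic_of_mem_romanoffFinset hK h1).1.leadingCoeff,
      (monic_of_mem_romanoffFinset hK h2).1.leadingCoeff, mul_one, mul_one] at this
    exact hcd (Units.ext this.symm)

theorem card_scaledRomanoffFinset_le [Fintype Fˣ] (n : ℕ) (g : F[X]) (K : ℕ) :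
    (scaledRomanoffFinset n g K).card ≤ Fintype.card Fˣ * ((irredsOfDegree F n).card * K) := by
  classical
  rw [scaledRomanoffFinset]
  refine Finset.card_biUnion_le_card_mul _ _ _ fun c _ => ?_
  exact Finset.card_image_le.trans (card_romanoffFinset_le n g _ K)

theorem monicRomanoffDensity_bounds {n : ℕ} {g : F[X]} (hg : 1 ≤ g.natDegree)
    (hn : g.natDegree ≤ n) :
    monicRomanoffDensity n g ≤ 2 / (g.natDegree : ℝ) ∧
      (0.01 : ℝ) / (g.natDegree : ℝ) < monicRomanoffDensity n g := by
  have hq := two_le_natCard (F := F)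
  have hY : 0 < (Nat.card F : ℝ) ^ n := by positivity
  have hδ : (0 : ℝ) < g.natDegree := by exact_mod_cast hg
  have hup := monicRomanoffSet_subset hg n
  constructor
  · rw [monicRomanoffDensity, div_le_iff₀ hY]
    refine le_trans ?_ (card_irredsOfDegree_mul_le hg hn)
    have h1 := Set.ncard_le_ncard hup (Finset.finite_toSet _)
    rw [Set.ncard_coe_finset] at h1
    exact_mod_cast h1.trans (card_romanoffFinset_le _ _ _ _)
  · obtain ⟨K, hK1, hK2, hK3⟩ := exists_ceil_div hg hn
    have h1 := Set.ncard_le_ncard (subset_monicRomanoffSet hK2)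
      ((Finset.finite_toSet _).subset hup)
    rw [Set.ncard_coe_finset] at h1
    have h2 := lt_card_romanoffFinset hg (one_ne_zero (α := F)) hK1 hK2 hK3
    have h3 : ((romanoffFinset n g (1 : F) K).card : ℝ) ≤ (monicRomanoffSet n g).ncard :=
      Nat.cast_le.2 h1
    rw [monicRomanoffDensity, div_lt_div_iff₀ hδ hY, mul_comm _ (g.natDegree : ℝ)]
    exact h2.trans_le (mul_le_mul_of_nonneg_left h3 hδ.le)

theorem romanoffDensity_bounds {n : ℕ} {g : F[X]} (hg : 1 ≤ g.natDegree)
    (hn : g.natDegree ≤ n) :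
    romanoffDensity n g ≤ 2 / (g.natDegree : ℝ) ∧
      (0.01 : ℝ) / (g.natDegree : ℝ) < romanoffDensity n g := by
  classical
  have := Fintype.ofFinite F
  have hq := two_le_natCard (F := F)
  have hq1 : (0 : ℝ) < (Nat.card F : ℝ) - 1 := by linarith
  have hU : (Fintype.card Fˣ : ℝ) = (Nat.card F : ℝ) - 1 := by
    rw [Fintype.card_units, Nat.card_eq_fintype_card, Nat.cast_sub Fintype.card_pos, Nat.cast_one]
  have hY : 0 < (Nat.card F : ℝ) ^ n := by positivity
  have hδ : (0 : ℝ) < g.natDegree := by exact_mod_cast hg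
  have hup := romanoffSet_subset hg n
  constructor
  · rw [romanoffDensity, div_le_iff₀ (by positivity), mul_left_comm]
    have h1 := Set.ncard_le_ncard hup (Finset.finite_toSet _)
    rw [Set.ncard_coe_finset] at h1
    have h2 : ((romanoffSet n g).ncard : ℝ) ≤ (Fintype.card Fˣ : ℝ) *
        ((irredsOfDegree F n).card * ((n / g.natDegree + 1 : ℕ) : ℝ)) := by
      exact_mod_cast h1.trans (card_scaledRomanoffFinset_le _ _ _)
    rw [hU] at h2
    exact h2.trans (mul_le_mul_of_nonneg_left (card_irredsOfDegree_mul_le hg hn) hq1.le)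
  · obtain ⟨K, hK1, hK2, hK3⟩ := exists_ceil_div hg hn
    have h1 := Set.ncard_le_ncard (subset_romanoffSet hK2)
      ((Finset.finite_toSet _).subset hup)
    rw [Set.ncard_coe_finset, card_scaledRomanoffFinset hK2] at h1
    have h3 : ∑ c : Fˣ, ((romanoffFinset n g ((c⁻¹ : Fˣ) : F) K).card : ℝ) ≤
        (romanoffSet n g).ncard := by exact_mod_cast h1
    rw [romanoffDensity, div_lt_div_iff₀ hδ (by positivity), mul_comm _ (g.natDegree : ℝ)]
    refine lt_of_lt_of_le ?_ (mul_le_mul_of_nonneg_left h3 hδ.le)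
    rw [Finset.mul_sum, mul_left_comm, ← hU, ← nsmul_eq_mul, ← Finset.card_univ, ← Finset.sum_const]
    refine Finset.sum_lt_sum_of_nonempty Finset.univ_nonempty fun c _ => ?_
    exact lt_card_romanoffFinset hg (Units.ne_zero _) hK1 hK2 hK3

end

theorem mainTheorem3 {F : Type*} [Field F] [Finite F] (n : ℕ) (g : F[X])
    (hg : 1 ≤ g.natDegree) (hn : g.natDegree ≤ n) :
    (monicRomanoffDensity n g ≤ 2 / (g.natDegree : ℝ) ∧
      (0.01 : ℝ) / (g.natDegree : ℝ) < monicRomanoffDensity n g) ∧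
    (romanoffDensity n g ≤ 2 / (g.natDegree : ℝ) ∧
      (0.01 : ℝ) / (g.natDegree : ℝ) < romanoffDensity n g) :=
  ⟨monicRomanoffDensity_bounds hg hn, romanoffDensity_bounds hg hn⟩
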